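/- Let $\mathcal{RH}_\infty^{p\times q}$ be the set of real-rational, proper transfer function matrices of size $p\times q$ all of whose poles lie in the open left half plane, and let $\overline{\sigma}(C)$ denote the largest singular value of a matrix $C$. For square real-rational $G,H$ of size $m$, the feedback system $G\#H$ is called stable if $I+GH$ is invertible as a rational matrix and $$G\#H=\begin{bmatrix} I-H(I+GH)^{-1}G & -H(I+GH)^{-1}\\ (I+GH)^{-1}G & (I+GH)^{-1}\end{bmatrix}\in\mathcal{RH}_\infty^{2m\times 2m}.$$ For a function $\gamma:\mathbb{R}\cup\{\infty\}\to\mathbb{R}$ let $$\mathcal{B}_s[\gamma]=\{H\in\mathcal{RH}_\infty^{m\times m}:\ H=H^T,\ \overline{\sigma}(H(j\omega))\le|\gamma(\omega)|\ \text{ for all } \omega\in[0,\infty]\}.$$ Call $\gamma$ a *regular bound* if the following holds at every $\omega_0\in[0,\infty]$, for $\omega\in[0,\infty)$ in a neighbourhood of $\omega_0$. - If $\gamma(\omega_0)\neq0$, then $|\gamma|$ has a quadratic minorant touching it at $\omega_0$: there are $a,K\in\mathbb{R}$ with $|\gamma(\omega)|\ge|\gamma(\omega_0)|+a(\omega-\omega_0)-K(\omega-\omega_0)^2$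 when $0<\omega_0<\infty$; there is $K\in\mathbb{R}$ with $|\gamma(\omega)|\ge|\gamma(0)|-K\omega^2$ when $\omega_0=0$, and with $|\gamma(\omega)|\ge|\gamma(\infty)|-K\omega^{-2}$ when $\omega_0=\infty$. - If $\gamma(\omega_0)=0$, then the zero is of finite order: there are $c>0$ and $k\in\mathbb{N}$ with $|\gamma(\omega)|\ge c|\omega-\omega_0|^k$ when $\omega_0<\infty$, and with $|\gamma(\omega)|\ge c\,\omega^{-k}$ when $\omega_0=\infty$. (For instance, every nonzero constant, every nowhere vanishing even $C^2$ function on $\mathbb{R}\cup\{\infty\}$, and every gain $|w(j\omega)|$ of a nonzero scalar $w\in\mathcal{RH}_\infty$ is a regular bound.) **Proposition.** Let $G\in\mathcal{RH}_\infty^{m\times m}$ be symmetric, i.e. $G=G^T$, and let $\gamma:\mathbb{R}\cup\{\infty\}\to\mathbb{R}$. Consider the small gain condition $$\overline{\sigma}(G(j\omega))<|\gamma(\omega)|^{-1}\quad\text{for all }\omega\in[0,\infty],\qquad(\ast)$$ where $|\gamma(\omega)|^{-1}=+\infty$ if $\gamma(\omega)=0$. 1. If $(\ast)$ holds, then $G\#H$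 is stable for all $H\in\mathcal{B}_s[\gamma]$. 2. If $\gamma$ is a regular bound, then $G\#H$ is stable for all $H\in\mathcal{B}_s[\gamma]$ if and only if $(\ast)$ holds. -/

import Mathlib

open Filter Topology

noncomputable section

namespace SmallGain

/-- A scalar real-rational transfer function is proper if its degree is at most zero. -/
def IsProper (r : RatFunc ℝ) : Prop :=
  r.num.natDegree ≤ r.denom.natDegree

/-- All poles lie in the open left half plane. Numerator and denominator of a `RatFunc` are
coprime, so the poles are exactly the complex roots of the denominator. -/
def PolesInOpenLeftHalfPlane (r : RatFunc ℝ) : Prop :=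
  ∀ s : ℂ, Polynomial.aeval s r.denom = 0 → s.re < 0

/-- The class of real-rational, proper and stable transfer function matrices. -/
def IsRHInfty {ι κ : Type*} (G : Matrix ι κ (RatFunc ℝ)) : Prop :=
  ∀ i j, IsProper (G i j) ∧ PolesInOpenLeftHalfPlane (G i j)

/-- The value at infinity of a proper rational function: the coefficient of the numerator in
degree `deg denom`, divided by the leading coefficient of the denominator. -/
def valueAtInfty (r : RatFunc ℝ) : ℝ :=
  r.num.coeff r.denom.natDegree / r.denom.leadingCoeff

/-- `G(jω)` for `ω ∈ ℝ ∪ {∞}`. -/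
def freqResponse {ι κ : Type*} (G : Matrix ι κ (RatFunc ℝ)) (ω : OnePoint ℝ) : Matrix ι κ ℂ :=
  ω.elim (G.map fun r => (valueAtInfty r : ℂ))
    (fun x => G.map fun r => RatFunc.eval (algebraMap ℝ ℂ) (Complex.I * (x : ℂ)) r)

/-- The closed half line of frequencies `[0, ∞]`, inside `ℝ ∪ {∞}`. -/
def frequencies : Set (OnePoint ℝ) :=
  insert OnePoint.infty ((fun x : ℝ => (x : OnePoint ℝ)) '' Set.Ici 0)

/-- The largest singular value (singular values are indexed from zero, in decreasing order). -/
def maxSingularValue {m : ℕ} (A : Matrix (Fin m) (Fin m) ℂ) : ℝ :=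
  (Matrix.toEuclideanLin A).singularValues 0

/-- The closed-loop transfer matrix `G # H` from the external inputs to the internal signals. -/
def closedLoop {m : ℕ} (G H : Matrix (Fin m) (Fin m) (RatFunc ℝ)) :
    Matrix (Fin m ⊕ Fin m) (Fin m ⊕ Fin m) (RatFunc ℝ) :=
  Matrix.fromBlocks
    (1 - H * (1 + G * H)⁻¹ * G) (-(H * (1 + G * H)⁻¹))
    ((1 + G * H)⁻¹ * G) ((1 + G * H)⁻¹)

/-- The feedback interconnection is stable: `I + GH` is invertible as a rational matrix, so that
`G # H` exists, and `G # H` is proper and stable. -/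
def FeedbackStable {m : ℕ} (G H : Matrix (Fin m) (Fin m) (RatFunc ℝ)) : Prop :=
  IsUnit (1 + G * H) ∧ IsRHInfty (closedLoop G H)

/-- The ball of stable systems with gain at most `|γ(ω)|` at every frequency `ω ∈ [0, ∞]`. -/
def ball (m : ℕ) (γ : OnePoint ℝ → ℝ) : Set (Matrix (Fin m) (Fin m) (RatFunc ℝ)) :=
  {H | IsRHInfty H ∧ ∀ ω ∈ frequencies, maxSingularValue (freqResponse H ω) ≤ |γ ω|}

/-- The ball of symmetric systems. -/
def symmBall (m : ℕ) (γ : OnePoint ℝ → ℝ) : Set (Matrix (Fin m) (Fin m) (RatFunc ℝ)) :=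
  {H | H ∈ ball m γ ∧ H.transpose = H}

/-- The small gain condition `σ̄(G(jω)) < |γ(ω)|⁻¹` on `[0, ∞]`, in `[0, ∞]`-valued arithmetic,
so that `|γ(ω)|⁻¹ = ∞` where `γ(ω) = 0`. -/
def SmallGainCondition {m : ℕ} (G : Matrix (Fin m) (Fin m) (RatFunc ℝ))
    (γ : OnePoint ℝ → ℝ) : Prop :=
  ∀ ω ∈ frequencies,
    ENNReal.ofReal (maxSingularValue (freqResponse G ω)) < (ENNReal.ofReal |γ ω|)⁻¹

/-- Regularity of a gain bound on `[0, ∞]`. Near a frequency where it does not vanish, `|γ|`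
has a quadratic minorant touching it there (without linear term at `0` and, in the variable
`1/ω`, at `∞`, as real-rational gains are even in `ω`); near a frequency where it vanishes, it is
bounded below by a power of the distance (of `1/ω` at `∞`). Every nonvanishing even `C²` function
on `ℝ ∪ {∞}`, in particular every nonzero constant, and the gain of every nonzero scalar stable
system is regular. -/
structure IsRegularBound (γ : OnePoint ℝ → ℝ) : Prop where
  minorant_pos : ∀ x : ℝ, 0 < x → γ x ≠ 0 →
    ∃ a K : ℝ, ∀ᶠ y : ℝ in 𝓝 x, |γ x| + a * (y - x) - K * (y - x) ^ 2 ≤ |γ y|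
  minorant_zero : γ (0 : ℝ) ≠ 0 →
    ∃ K : ℝ, ∀ᶠ y : ℝ in 𝓝[≥] 0, |γ (0 : ℝ)| - K * y ^ 2 ≤ |γ y|
  minorant_infty : γ OnePoint.infty ≠ 0 →
    ∃ K : ℝ, ∀ᶠ y : ℝ in atTop, |γ OnePoint.infty| - K * (y⁻¹) ^ 2 ≤ |γ y|
  finite_order : ∀ x : ℝ, 0 ≤ x → γ x = 0 →
    ∃ c : ℝ, 0 < c ∧ ∃ k : ℕ, ∀ᶠ y : ℝ in 𝓝[Set.Ici 0] x, c * |y - x| ^ k ≤ |γ y|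
  finite_order_infty : γ OnePoint.infty = 0 →
    ∃ c : ℝ, 0 < c ∧ ∃ k : ℕ, ∀ᶠ y : ℝ in atTop, c * (y⁻¹) ^ k ≤ |γ y|

end SmallGain

end

open Filter Topology

noncomputable section

namespace SmallGain

/-! Stable proper transfer functions form a ring `rhInfty`, on which evaluation at a point of the
closed right half plane, or at infinity, is a ring homomorphism. Feedback stability is invertibility
of `1 + G * H` over this ring (`feedbackStable_iff`), and an element is a unit exactly when no such
evaluation kills it.

Sufficiency: the loop gain is below one on the whole imaginary axis, by Phragmén–Lindelöf below one
on the half plane, so `det (1 + G * H)` has no zero there (`isUnit_one_add_of_norm_lt_one`).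

Necessity: suppose the gain condition fails at `ω₀`. In the coordinate `t = 1 / (1 + ω²)` a regular
bound has a polynomial `Q` with `|Q| ≤ |γ|` and equality at `ω₀`
(`IsRegularOnIcc.exists_polynomial_touching`), and `|Q|` is the gain of some scalar `e`
(`exists_norm_evalFreq_eq_abs_eval`). Since `A = G(jω₀)` is complex symmetric, it has a Takagi
vector, `A v = σ v̄` with `σ` its largest singular value. A rank-one `H = h w wᵀ`, with `h` a
multiple of `e` and `w` of unit norm at all frequencies and aligned with `v` at `ω₀`, makes `1 + G *
H` singular there. At `0` and `∞` all values are real, so `v` must be real too. -/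

/-! ### The ring of stable transfer functions and its evaluations -/

theorem isProper_iff_intDegree_nonpos (r : RatFunc ℝ) : IsProper r ↔ r.intDegree ≤ 0 := by
  unfold IsProper RatFunc.intDegree
  omega

theorem PolesInOpenLeftHalfPlane.eval₂_denom_ne_zero {r : RatFunc ℝ}
    (h : PolesInOpenLeftHalfPlane r) {s : ℂ} (hs : 0 ≤ s.re) :
    Polynomial.eval₂ (algebraMap ℝ ℂ) s r.denom ≠ 0 := fun h0 =>
  absurd (h s (by rwa [Polynomial.aeval_def])) (not_lt.2 hs)

theorem polesInOpenLeftHalfPlane_of_dvd {r : RatFunc ℝ} {p : Polynomial ℝ} (h : r.denom ∣ p)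
    (hp : ∀ s : ℂ, 0 ≤ s.re → Polynomial.aeval s p ≠ 0) : PolesInOpenLeftHalfPlane r := by
  intro s hs
  by_contra! hre
  obtain ⟨q, rfl⟩ := h
  exact hp s hre (by rw [map_mul, hs, zero_mul])

/-- The ring of real-rational, proper and stable scalar transfer functions. -/
def rhInfty : Subring (RatFunc ℝ) where
  carrier := {r | IsProper r ∧ PolesInOpenLeftHalfPlane r}
  mul_mem' := by
    rintro x y ⟨hx, hx'⟩ ⟨hy, hy'⟩
    refine ⟨?_, polesInOpenLeftHalfPlane_of_dvd (RatFunc.denom_mul_dvd x y) fun s hs => ?_⟩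
    · rw [isProper_iff_intDegree_nonpos] at *
      rcases eq_or_ne x 0 with rfl | hx0
      · simp
      rcases eq_or_ne y 0 with rfl | hy0
      · simp
      rw [RatFunc.intDegree_mul hx0 hy0]
      omega
    · rw [map_mul]
      exact mul_ne_zero (hx'.eval₂_denom_ne_zero hs) (hy'.eval₂_denom_ne_zero hs)
  one_mem' := by simp [IsProper, PolesInOpenLeftHalfPlane]
  add_mem' := by
    rintro x y ⟨hx, hx'⟩ ⟨hy, hy'⟩
    refine ⟨?_, polesInOpenLeftHalfPlane_of_dvd (RatFunc.denom_add_dvd x y) fun s hs => ?_⟩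
    · rw [isProper_iff_intDegree_nonpos] at *
      rcases eq_or_ne y 0 with rfl | hy0
      · simpa using hx
      rcases eq_or_ne (x + y) 0 with hxy | hxy
      · simp [hxy]
      exact (RatFunc.intDegree_add_le hy0 hxy).trans (max_le hx hy)
    · rw [map_mul]
      exact mul_ne_zero (hx'.eval₂_denom_ne_zero hs) (hy'.eval₂_denom_ne_zero hs)
  zero_mem' := by simp [IsProper, PolesInOpenLeftHalfPlane]
  neg_mem' := by
    rintro x ⟨hx, hx'⟩
    refine ⟨?_, polesInOpenLeftHalfPlane_of_dvd (p := x.denom) ?_ fun s hs =>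
      hx'.eval₂_denom_ne_zero hs⟩
    · rw [isProper_iff_intDegree_nonpos] at *
      simpa using hx
    · have h := RatFunc.denom_mul_dvd (RatFunc.C (-1)) x
      rw [RatFunc.denom_C, one_mul] at h
      simpa using h

/-- Evaluation of a stable transfer function at a point of the closed right half plane. -/
def evalAt (s : ℂ) (hs : 0 ≤ s.re) : rhInfty →+* ℂ where
  toFun r := RatFunc.eval (algebraMap ℝ ℂ) s r
  map_zero' := by simp
  map_one' := by simp
  map_mul' x y := RatFunc.eval_mul _ _ (x.2.2.eval₂_denom_ne_zero hs) (y.2.2.eval₂_denom_ne_zero hs)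
  map_add' x y := RatFunc.eval_add _ _ (x.2.2.eval₂_denom_ne_zero hs) (y.2.2.eval₂_denom_ne_zero hs)

theorem evalAt_apply (s : ℂ) (hs : 0 ≤ s.re) (r : rhInfty) :
    evalAt s hs r = RatFunc.eval (algebraMap ℝ ℂ) s (r : RatFunc ℝ) := rfl

/-- Reversing the coefficients turns behaviour at infinity into continuity at zero. -/
theorem tendsto_eval₂_reflect_cobounded (p : Polynomial ℝ) (n : ℕ) :
    Tendsto (fun s : ℂ => Polynomial.eval₂ (algebraMap ℝ ℂ) s⁻¹ (p.reflect n))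
      (Bornology.cobounded ℂ) (𝓝 (p.coeff n : ℂ)) := by
  have h : Continuous fun z : ℂ => Polynomial.eval₂ (algebraMap ℝ ℂ) z (p.reflect n) := by
    simpa [Polynomial.aeval_def] using (p.reflect n).continuous_aeval (A := ℂ)
  have h0 : Polynomial.eval₂ (algebraMap ℝ ℂ) 0 (p.reflect n) = (p.coeff n : ℂ) := by
    rw [Polynomial.eval₂_at_zero, Polynomial.coeff_reflect, Polynomial.revAt_le (Nat.zero_le n)]
    simp
  have := (h.tendsto 0).comp (tendsto_inv₀_cobounded (α := ℂ))
  rwa [h0] at this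

theorem tendsto_eval_cobounded {r : RatFunc ℝ} (hr : IsProper r) :
    Tendsto (fun s : ℂ => RatFunc.eval (algebraMap ℝ ℂ) s r)
      (Bornology.cobounded ℂ) (𝓝 (valueAtInfty r : ℂ)) := by
  have hd : (r.denom.coeff r.denom.natDegree : ℂ) ≠ 0 := by
    simpa using RatFunc.denom_ne_zero r
  have h := (tendsto_eval₂_reflect_cobounded r.num r.denom.natDegree).div
    (tendsto_eval₂_reflect_cobounded r.denom r.denom.natDegree) hd
  have hv : (valueAtInfty r : ℂ) =
      (r.num.coeff r.denom.natDegree : ℂ) / (r.denom.coeff r.denom.natDegree : ℂ) := by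
    simp [valueAtInfty]
  rw [hv]
  refine h.congr' ?_
  have hne : ∀ᶠ s : ℂ in Bornology.cobounded ℂ, s ≠ 0 :=
    (Metric.hasBasis_cobounded_compl_closedBall (0 : ℂ)).eventually_iff.2
      ⟨0, trivial, fun s hs h0 => hs (by simp [h0])⟩
  filter_upwards [hne] with s hs
  have := invertibleOfNonzero hs
  have h1 := Polynomial.eval₂_reflect_mul_pow (algebraMap ℝ ℂ) s r.denom.natDegree r.num hr
  have h2 := Polynomial.eval₂_reflect_mul_pow (algebraMap ℝ ℂ) s r.denom.natDegree r.denom le_rfl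
  rw [invOf_eq_inv] at h1 h2
  rw [RatFunc.eval, ← h1, ← h2, Pi.div_apply, mul_div_mul_right _ _ (pow_ne_zero _ hs)]

theorem tendsto_eval_ofReal_atTop {r : RatFunc ℝ} (hr : IsProper r) :
    Tendsto (fun x : ℝ => RatFunc.eval (algebraMap ℝ ℂ) (x : ℂ) r)
      atTop (𝓝 (valueAtInfty r : ℂ)) := by
  refine (tendsto_eval_cobounded hr).comp ?_
  rw [← tendsto_norm_atTop_iff_cobounded]
  simpa using tendsto_abs_atTop_atTop

/-- The value at infinity of a stable transfer function. -/
def evalInfty : rhInfty →+* ℂ where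
  toFun r := (valueAtInfty r : ℂ)
  map_zero' := by simp [valueAtInfty]
  map_one' := by simp [valueAtInfty]
  map_mul' x y := by
    -- The value at infinity is a limit along the positive reals, where evaluation is already
    -- multiplicative.
    refine tendsto_nhds_unique (tendsto_eval_ofReal_atTop (x * y).2.1)
      (((tendsto_eval_ofReal_atTop x.2.1).mul (tendsto_eval_ofReal_atTop y.2.1)).congr' ?_)
    filter_upwards [eventually_ge_atTop 0] with t ht
    exact ((evalAt t (by simpa using ht)).map_mul x y).symm
  map_add' x y := by
    refine tendsto_nhds_unique (tendsto_eval_ofReal_atTop (x + y).2.1)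
      (((tendsto_eval_ofReal_atTop x.2.1).add (tendsto_eval_ofReal_atTop y.2.1)).congr' ?_)
    filter_upwards [eventually_ge_atTop 0] with t ht
    exact ((evalAt t (by simpa using ht)).map_add x y).symm

theorem evalInfty_apply (r : rhInfty) : evalInfty r = (valueAtInfty (r : RatFunc ℝ) : ℂ) := rfl

theorem continuousOn_evalAt (r : rhInfty) :
    ContinuousOn (fun s : ℂ => RatFunc.eval (algebraMap ℝ ℂ) s (r : RatFunc ℝ)) {s | 0 ≤ s.re} := by
  have h (p : Polynomial ℝ) : Continuous fun z : ℂ => Polynomial.eval₂ (algebraMap ℝ ℂ) z p := by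
    simpa [Polynomial.aeval_def] using p.continuous_aeval (A := ℂ)
  exact (h _).continuousOn.div (h _).continuousOn fun s hs => r.2.2.eval₂_denom_ne_zero hs

theorem differentiableOn_evalAt (r : rhInfty) :
    DifferentiableOn ℂ (fun s : ℂ => RatFunc.eval (algebraMap ℝ ℂ) s (r : RatFunc ℝ))
      {s | 0 ≤ s.re} := by
  have h (p : Polynomial ℝ) :
      Differentiable ℂ fun z : ℂ => Polynomial.eval₂ (algebraMap ℝ ℂ) z p := by
    simpa [Polynomial.aeval_def] using p.differentiable_aeval (𝕜 := ℂ)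
  exact (h _).differentiableOn.div (h _).differentiableOn fun s hs =>
    r.2.2.eval₂_denom_ne_zero hs

theorem evalAt_conj (r : RatFunc ℝ) (s : ℂ) :
    RatFunc.eval (algebraMap ℝ ℂ) (starRingEnd ℂ s) r =
      starRingEnd ℂ (RatFunc.eval (algebraMap ℝ ℂ) s r) := by
  have h (p : Polynomial ℝ) : Polynomial.eval₂ (algebraMap ℝ ℂ) (starRingEnd ℂ s) p =
      starRingEnd ℂ (Polynomial.eval₂ (algebraMap ℝ ℂ) s p) := by
    rw [Polynomial.hom_eval₂]
    congr 1
    ext x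
    simp
  simp [RatFunc.eval, h]

/-- The poles of `r⁻¹` are zeros of `r`, and a nonzero value at infinity forces equal degrees, so
`r⁻¹` is again stable and proper. -/
theorem isUnit_rhInfty {r : rhInfty} (h : ∀ (s : ℂ) (hs : 0 ≤ s.re), evalAt s hs r ≠ 0)
    (hinf : evalInfty r ≠ 0) : IsUnit r := by
  have hr0 : (r : RatFunc ℝ) ≠ 0 := by
    intro h0
    apply hinf
    rw [show r = 0 from Subtype.ext h0, map_zero]
  have hmem : (r : RatFunc ℝ)⁻¹ ∈ rhInfty := by
    refine ⟨?_, polesInOpenLeftHalfPlane_of_dvd (RatFunc.denom_inv_dvd hr0) fun s hs h0 => ?_⟩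
    · rw [isProper_iff_intDegree_nonpos, RatFunc.intDegree_inv]
      have : (r : RatFunc ℝ).num.coeff (r : RatFunc ℝ).denom.natDegree ≠ 0 := by
        intro h0
        apply hinf
        simp [evalInfty_apply, valueAtInfty, h0]
      have := Polynomial.le_natDegree_of_ne_zero this
      unfold RatFunc.intDegree
      omega
    · apply h s hs
      rw [evalAt_apply, RatFunc.eval, ← Polynomial.aeval_def, h0, zero_div]
  refine IsUnit.of_mul_eq_one ⟨_, hmem⟩ (Subtype.ext ?_)
  exact mul_inv_cancel₀ hr0

/-- Evaluation of a stable transfer function at `jω` for `ω ∈ ℝ ∪ {∞}`. -/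
def evalFreq (ω : OnePoint ℝ) : rhInfty →+* ℂ :=
  ω.elim evalInfty fun x => evalAt (Complex.I * x) (by simp)

theorem evalFreq_infty : evalFreq OnePoint.infty = evalInfty := rfl

theorem evalFreq_coe (x : ℝ) :
    evalFreq (x : OnePoint ℝ) = evalAt (Complex.I * x) (by simp) := rfl

theorem freqResponse_map {ι κ : Type*} (G : Matrix ι κ rhInfty) (ω : OnePoint ℝ) :
    freqResponse (G.map Subtype.val) ω = G.map (evalFreq ω) := by
  induction ω using OnePoint.rec <;> rfl

theorem IsRHInfty.exists_lift {ι κ : Type*} {G : Matrix ι κ (RatFunc ℝ)} (hG : IsRHInfty G) :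
    ∃ G' : Matrix ι κ rhInfty, G'.map Subtype.val = G :=
  ⟨fun i j => ⟨G i j, hG i j⟩, rfl⟩

theorem isRHInfty_map {ι κ : Type*} (G : Matrix ι κ rhInfty) : IsRHInfty (G.map Subtype.val) :=
  fun i j => (G i j).2

/-- The lower right block of the closed loop is the inverse of `1 + G * H` itself; conversely all
four blocks are polynomial expressions in `G`, `H` and that inverse. -/
theorem feedbackStable_iff {m : ℕ} (G H : Matrix (Fin m) (Fin m) rhInfty) :
    FeedbackStable (G.map Subtype.val) (H.map Subtype.val) ↔ IsUnit (1 + G * H) := by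
  have hmap (A : Matrix (Fin m) (Fin m) rhInfty) :
      A.map Subtype.val = rhInfty.subtype.mapMatrix A := rfl
  have hlift : (1 + G.map Subtype.val * H.map Subtype.val : Matrix (Fin m) (Fin m) (RatFunc ℝ)) =
      rhInfty.subtype.mapMatrix (1 + G * H) := by
    rw [map_add, map_one, map_mul, hmap, hmap]
  constructor
  · rintro ⟨hu, hcl⟩
    have hS : IsRHInfty (1 + G.map Subtype.val * H.map Subtype.val :
        Matrix (Fin m) (Fin m) (RatFunc ℝ))⁻¹ := fun i j => hcl (Sum.inr i) (Sum.inr j)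
    obtain ⟨S, hS⟩ := hS.exists_lift
    refine IsUnit.of_mul_eq_one S (Matrix.map_injective Subtype.val_injective ?_)
    change ((1 + G * H) * S).map Subtype.val = (1 : Matrix (Fin m) (Fin m) rhInfty).map Subtype.val
    rw [hmap, map_mul, ← hlift, ← hmap, hS, Matrix.mul_nonsing_inv _
      ((Matrix.isUnit_iff_isUnit_det _).1 hu), hmap, map_one]
  · intro hu
    obtain ⟨S, hS⟩ := hu.exists_right_inv
    have hinv : (1 + G.map Subtype.val * H.map Subtype.val :
        Matrix (Fin m) (Fin m) (RatFunc ℝ))⁻¹ = rhInfty.subtype.mapMatrix S := by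
      apply Matrix.inv_eq_right_inv
      rw [hlift, ← map_mul, hS, map_one]
    refine ⟨by rw [hlift]; exact hu.map _, ?_⟩
    have : closedLoop (G.map Subtype.val) (H.map Subtype.val) =
        (Matrix.fromBlocks (1 - H * S * G) (-(H * S)) (S * G) S).map Subtype.val := by
      rw [closedLoop, hinv, Matrix.fromBlocks_map]
      simp only [hmap, map_sub, map_one, map_mul, map_neg]
    rw [this]
    exact isRHInfty_map _

theorem isUnit_matrix_rhInfty {m : ℕ} {A : Matrix (Fin m) (Fin m) rhInfty}
    (h : ∀ (s : ℂ) (hs : 0 ≤ s.re), (A.map (evalAt s hs)).det ≠ 0)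
    (hinf : (A.map evalInfty).det ≠ 0) : IsUnit A := by
  rw [Matrix.isUnit_iff_isUnit_det]
  refine isUnit_rhInfty (fun s hs => ?_) ?_
  · rw [RingHom.map_det]
    exact h s hs
  · rw [RingHom.map_det]
    exact hinf

/-! ### Polynomials below a regular bound on `[0, 1]` -/

open Polynomial in
theorem exists_eval_eq_taylor_two (p : ℝ[X]) (x : ℝ) :
    ∃ M : ℝ, ∀ t ∈ Set.Icc (0 : ℝ) 1,
      p.eval t ≤ p.eval x + p.derivative.eval x * (t - x) + M * (t - x) ^ 2 := by
  have h1 : (X - C x) ∣ p - C (p.eval x) := by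
    rw [dvd_iff_isRoot]; simp
  obtain ⟨q, hq⟩ := h1
  have h2 : (X - C x) ∣ q - C (q.eval x) := by
    rw [dvd_iff_isRoot]; simp
  obtain ⟨r, hr⟩ := h2
  have hd : p.derivative.eval x = q.eval x := by
    have := congrArg (fun f => (derivative f).eval x) hq
    simpa using this
  obtain ⟨M, hM⟩ := (isCompact_Icc (a := (0 : ℝ)) (b := 1)).bddAbove_image
    r.continuous.continuousOn
  refine ⟨M, fun t ht => ?_⟩
  have e1 := congrArg (eval t) hq
  have e2 := congrArg (eval t) hr
  simp only [eval_sub, eval_mul, eval_X, eval_C] at e1 e2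
  have hMt : r.eval t ≤ M := hM ⟨t, ht, rfl⟩
  have : p.eval t = p.eval x + p.derivative.eval x * (t - x) + r.eval t * (t - x) ^ 2 := by
    rw [hd]; linear_combination e1 + (t - x) * e2
  rw [this]
  gcongr

/-- Bernoulli's inequality. With `z = (t - x) ^ 2`, the factor `(1 - z) ^ n` absorbs a quadratic
excess of relative size `n * z`. -/
theorem one_sub_pow_mul_one_add_le_one {z : ℝ} (h0 : 0 ≤ z) (h1 : z ≤ 1) (n : ℕ) :
    (1 - z) ^ n * (1 + n * z) ≤ 1 := by
  calc (1 - z) ^ n * (1 + n * z) ≤ (1 - z) ^ n * (1 + z) ^ n := by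
        gcongr
        exact one_add_mul_le_pow (by linarith) n
    _ = (1 - z ^ 2) ^ n := by rw [← mul_pow]; ring
    _ ≤ 1 := pow_le_one₀ (by nlinarith) (by nlinarith)

/-- A gain bound on `[0, 1]` that is regular: near each point it has a touching quadratic minorant,
or else a zero of finite order there. -/
structure IsRegularOnIcc (Γ : ℝ → ℝ) : Prop where
  nonneg : ∀ t ∈ Set.Icc (0 : ℝ) 1, 0 ≤ Γ t
  minorant : ∀ x ∈ Set.Icc (0 : ℝ) 1, Γ x ≠ 0 →
    ∃ a K : ℝ, ∀ᶠ t in 𝓝[Set.Icc 0 1] x, Γ x + a * (t - x) - K * (t - x) ^ 2 ≤ Γ t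
  finite_order : ∀ x ∈ Set.Icc (0 : ℝ) 1, Γ x = 0 →
    ∃ c : ℝ, 0 < c ∧ ∃ k : ℕ, ∀ᶠ t in 𝓝[Set.Icc 0 1] x, c * |t - x| ^ k ≤ Γ t

open Polynomial in
/-- A polynomial below a regular bound, not vanishing at a prescribed point where the bound does
not vanish. -/
theorem IsRegularOnIcc.exists_polynomial_le {Γ : ℝ → ℝ} (hΓ : IsRegularOnIcc Γ) {x : ℝ}
    (hx : Γ x ≠ 0) :
    ∃ b : ℝ[X], b.eval x ≠ 0 ∧ ∃ c : ℝ, 0 < c ∧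
      ∀ t ∈ Set.Icc (0 : ℝ) 1, c * |b.eval t| ≤ Γ t := by
  -- Local choices are glued by multiplying them: the added bound `|b| ≤ 1` on all of `[0, 1]`
  -- ensures that a further factor never spoils an estimate. The repeated membership becomes the
  -- condition needed for general `S` in the compactness induction.
  suffices H : ∃ b : ℝ[X], b.eval x ≠ 0 ∧ (∀ t ∈ Set.Icc (0 : ℝ) 1, |b.eval t| ≤ 1) ∧
      ∃ c : ℝ, 0 < c ∧ ∀ t ∈ Set.Icc (0 : ℝ) 1, t ∈ Set.Icc (0 : ℝ) 1 → c * |b.eval t| ≤ Γ t by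
    obtain ⟨b, hb, -, c, hc, h⟩ := H
    exact ⟨b, hb, c, hc, fun t ht => h t ht ht⟩
  refine (isCompact_Icc (a := (0 : ℝ)) (b := 1)).induction_on (p := fun S : Set ℝ =>
    ∃ b : ℝ[X], b.eval x ≠ 0 ∧ (∀ t ∈ Set.Icc (0 : ℝ) 1, |b.eval t| ≤ 1) ∧
      ∃ c : ℝ, 0 < c ∧ ∀ t ∈ S, t ∈ Set.Icc (0 : ℝ) 1 → c * |b.eval t| ≤ Γ t) ?_ ?_ ?_ ?_
  · exact ⟨1, by simp, by simp, 1, one_pos, by simp⟩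
  · rintro S T hST ⟨b, hb, hb1, c, hc, h⟩
    exact ⟨b, hb, hb1, c, hc, fun t ht => h t (hST ht)⟩
  · rintro S T ⟨b, hb, hb1, c, hc, h⟩ ⟨b', hb', hb1', c', hc', h'⟩
    refine ⟨b * b', by simp [hb, hb'], fun t ht => ?_, min c c', lt_min hc hc', ?_⟩
    · rw [eval_mul, abs_mul]
      exact mul_le_one₀ (hb1 t ht) (abs_nonneg _) (hb1' t ht)
    · rintro t (ht | ht) htI
      · refine le_trans ?_ (h t ht htI)
        rw [eval_mul, abs_mul]
        exact mul_le_mul (min_le_left _ _) (mul_le_of_le_one_right (abs_nonneg _) (hb1' t htI))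
          (by positivity) hc.le
      · refine le_trans ?_ (h' t ht htI)
        rw [eval_mul, abs_mul]
        exact mul_le_mul (min_le_right _ _) (mul_le_of_le_one_left (abs_nonneg _) (hb1 t htI))
          (by positivity) hc'.le
  · intro z hz
    by_cases hz0 : Γ z = 0
    · obtain ⟨c, hc, k, hev⟩ := hΓ.finite_order z hz hz0
      have hzx : x - z ≠ 0 := by
        intro h
        exact hx (by rwa [sub_eq_zero.1 h])
      refine ⟨_, hev, (X - C z) ^ k, by simp [hzx], fun t ht => ?_, c, hc, fun t ht _ => ?_⟩
      · simp only [eval_pow, eval_sub, eval_X, eval_C, abs_pow]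
        refine pow_le_one₀ (abs_nonneg _) (abs_le.2 ⟨?_, ?_⟩) <;>
          linarith [ht.1, ht.2, hz.1, hz.2]
      · simpa using ht
    · obtain ⟨a, K, hev⟩ := hΓ.minorant z hz hz0
      have hpos : 0 < Γ z := lt_of_le_of_ne (hΓ.nonneg z hz) (Ne.symm hz0)
      have hcont : Continuous fun t : ℝ => Γ z + a * (t - z) - K * (t - z) ^ 2 := by fun_prop
      have hlt : ∀ᶠ t in 𝓝[Set.Icc 0 1] z, Γ z / 2 < Γ z + a * (t - z) - K * (t - z) ^ 2 := by
        refine nhdsWithin_le_nhds ((hcont.tendsto z).eventually_const_lt ?_)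
        simpa using half_lt_self hpos
      refine ⟨_, hev.and hlt, 1, by simp, by simp, Γ z / 2, half_pos hpos, fun t ht _ => ?_⟩
      simpa using ht.2.le.trans ht.1

-- Start from `E`, a multiple of `b` with value `Γ x` and slope `a` at `x`, and multiply by the peak
-- `(1 - (t - x) ^ 2) ^ n`. Near `x`, `E` exceeds the quadratic minorant by at most `(K + M) * (t -
-- x) ^ 2`, which the peak absorbs for large `n`. Away from `x` the peak is geometrically small, and
-- the factor `b` keeps the product below `Γ` even at the zeros of `Γ`.
open Polynomial in
theorem IsRegularOnIcc.exists_polynomial_touching {Γ : ℝ → ℝ} (hΓ : IsRegularOnIcc Γ) {x : ℝ}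
    (hxI : x ∈ Set.Icc (0 : ℝ) 1) (hx : Γ x ≠ 0) :
    ∃ Q : ℝ[X], Q.eval x = Γ x ∧ ∀ t ∈ Set.Icc (0 : ℝ) 1, |Q.eval t| ≤ Γ t := by
  have hpos : 0 < Γ x := lt_of_le_of_ne (hΓ.nonneg x hxI) (Ne.symm hx)
  obtain ⟨b, hb, c, hc, hbΓ⟩ := hΓ.exists_polynomial_le hx
  obtain ⟨a, K, hev⟩ := hΓ.minorant x hxI hx
  -- Chosen so that the logarithmic derivative of `E` at `x` is `a / Γ x`.
  set κ : ℝ := a / Γ x - b.derivative.eval x / b.eval x with hκ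
  set E : ℝ[X] := C (Γ x / b.eval x) * b * (1 + C κ * (X - C x)) with hE
  have hEx : E.eval x = Γ x := by
    simp [hE, div_mul_cancel₀ _ hb]
  have hEd : E.derivative.eval x = a := by
    simp [hE, hκ, derivative_mul]
    field_simp
    ring
  obtain ⟨M, hM⟩ := exists_eval_eq_taylor_two E x
  rw [hEx, hEd] at hM
  have hmin : ∀ᶠ t in 𝓝[Set.Icc 0 1] x, Γ x / 2 < Γ x + a * (t - x) - K * (t - x) ^ 2 := by
    have hcont : Continuous fun t : ℝ => Γ x + a * (t - x) - K * (t - x) ^ 2 := by fun_prop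
    refine nhdsWithin_le_nhds ((hcont.tendsto x).eventually_const_lt ?_)
    simpa using half_lt_self hpos
  have hEpos : ∀ᶠ t in 𝓝[Set.Icc 0 1] x, 0 < E.eval t :=
    nhdsWithin_le_nhds ((E.continuous.tendsto x).eventually_const_lt (by rwa [hEx]))
  obtain ⟨δ, hδ, hball⟩ := Metric.mem_nhdsWithin_iff.1 (hev.and (hmin.and hEpos))
  obtain ⟨B, hB⟩ : ∃ B, ∀ t ∈ Set.Icc (0 : ℝ) 1, |E.eval t| ≤ B * |b.eval t| := by
    have hcont : Continuous fun t : ℝ => |Γ x / b.eval x * (1 + κ * (t - x))| := by fun_prop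
    obtain ⟨B, hB⟩ := (isCompact_Icc (a := (0 : ℝ)) (b := 1)).bddAbove_image hcont.continuousOn
    refine ⟨B, fun t ht => ?_⟩
    have : |Γ x / b.eval x * (1 + κ * (t - x))| ≤ B := hB ⟨t, ht, rfl⟩
    calc |E.eval t| = |Γ x / b.eval x * (1 + κ * (t - x))| * |b.eval t| := by
          rw [← abs_mul]; congr 1; simp [hE]; ring
      _ ≤ B * |b.eval t| := by gcongr
  -- Bounds the base of the peak outside the `δ`-neighbourhood; the maximum covers `δ > 1`.
  set ρ : ℝ := max 0 (1 - δ ^ 2) with hρ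
  have hρ0 : 0 ≤ ρ := le_max_left _ _
  have hρ1 : ρ < 1 := max_lt one_pos (by nlinarith)
  have hfar : ∀ᶠ n : ℕ in atTop, |B| * ρ ^ n < c := by
    have := (tendsto_pow_atTop_nhds_zero_of_lt_one hρ0 hρ1).const_mul |B|
    rw [mul_zero] at this
    exact this.eventually_lt_const hc
  -- The minorant exceeds `Γ x / 2` near `x`, so this makes the excess at most `n * (t - x) ^ 2`
  -- times the minorant.
  have hnear : ∀ᶠ n : ℕ in atTop, 2 * (K + M) / Γ x ≤ n :=
    tendsto_natCast_atTop_atTop.eventually_ge_atTop _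
  obtain ⟨n, hn1, hn2⟩ := (hfar.and hnear).exists
  refine ⟨E * (1 - (X - C x) ^ 2) ^ n, by simp [hEx], fun t ht => ?_⟩
  have hd1 : (t - x) ^ 2 ≤ 1 := by
    rw [sq_le_one_iff_abs_le_one, abs_le]
    constructor <;> linarith [ht.1, ht.2, hxI.1, hxI.2]
  have hP : 0 ≤ (1 - (t - x) ^ 2) ^ n := pow_nonneg (by linarith) n
  simp only [eval_mul, eval_pow, eval_sub, eval_one, eval_X, eval_C, abs_mul, abs_of_nonneg hP]
  by_cases hnr : |t - x| < δ
  · obtain ⟨h1, h2, h3⟩ := hball ⟨by simpa [Real.dist_eq] using hnr, ht⟩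
    refine le_trans ?_ h1
    rw [abs_of_pos h3]
    set L := Γ x + a * (t - x) - K * (t - x) ^ 2 with hL
    have hn2' : K + M ≤ n * (Γ x / 2) := by
      rw [div_le_iff₀ hpos] at hn2
      linarith
    have hEL : E.eval t ≤ L * (1 + n * (t - x) ^ 2) := by
      have e1 := hM t ht
      have e2 : (K + M) * (t - x) ^ 2 ≤ n * (Γ x / 2) * (t - x) ^ 2 := by gcongr
      have e3 : Γ x / 2 * (n * (t - x) ^ 2) ≤ L * (n * (t - x) ^ 2) := by
        gcongr
      linarith
    have hL0 : 0 ≤ L := by linarith [h2]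
    calc E.eval t * (1 - (t - x) ^ 2) ^ n
        ≤ L * (1 + n * (t - x) ^ 2) * (1 - (t - x) ^ 2) ^ n := by gcongr
      _ = L * ((1 - (t - x) ^ 2) ^ n * (1 + n * (t - x) ^ 2)) := by ring
      _ ≤ L * 1 := by
          gcongr
          exact one_sub_pow_mul_one_add_le_one (sq_nonneg _) hd1 n
      _ = L := mul_one L
  · have hδ2 : δ ^ 2 ≤ (t - x) ^ 2 := by
      rw [← sq_abs (t - x)]
      push Not at hnr
      gcongr
    have hPρ : (1 - (t - x) ^ 2) ^ n ≤ ρ ^ n :=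
      pow_le_pow_left₀ (by linarith) ((by linarith : 1 - (t - x) ^ 2 ≤ 1 - δ ^ 2).trans
        (le_max_right _ _)) n
    calc |E.eval t| * (1 - (t - x) ^ 2) ^ n ≤ |B| * |b.eval t| * ρ ^ n := by
          gcongr
          exact (hB t ht).trans (by gcongr; exact le_abs_self B)
      _ = (|B| * ρ ^ n) * |b.eval t| := by ring
      _ ≤ c * |b.eval t| := by gcongr
      _ ≤ Γ t := hbΓ t ht

/-! ### Regularity in the coordinate `1 / (1 + ω²)` -/

/-- The coordinate `1 / (1 + ω²)` on `[0, ∞]`, with values in `[0, 1]`. -/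
def freqCoord (ω : OnePoint ℝ) : ℝ :=
  ω.elim 0 fun x => (1 + x ^ 2)⁻¹

/-- The frequency with a given coordinate `1 / (1 + ω²)`. -/
def freqOfCoord (t : ℝ) : OnePoint ℝ :=
  if t = 0 then OnePoint.infty else ((√(t⁻¹ - 1) : ℝ) : OnePoint ℝ)

theorem freqCoord_infty : freqCoord OnePoint.infty = 0 := rfl

theorem freqCoord_coe (x : ℝ) : freqCoord (x : OnePoint ℝ) = (1 + x ^ 2)⁻¹ := rfl

theorem freqCoord_mem_Icc (ω : OnePoint ℝ) : freqCoord ω ∈ Set.Icc (0 : ℝ) 1 := by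
  induction ω using OnePoint.rec with
  | infty => simp [freqCoord_infty]
  | coe x =>
    rw [freqCoord_coe]
    exact ⟨by positivity, inv_le_one_of_one_le₀ (by nlinarith [sq_nonneg x])⟩

theorem freqOfCoord_freqCoord {ω : OnePoint ℝ} (hω : ω ∈ frequencies) :
    freqOfCoord (freqCoord ω) = ω := by
  rcases hω with rfl | ⟨x, hx, rfl⟩
  · simp [freqCoord_infty, freqOfCoord]
  · have h : (1 + x ^ 2)⁻¹ ≠ 0 := by positivity
    simp only [freqCoord_coe, freqOfCoord, if_neg h, inv_inv, add_sub_cancel_left]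
    rw [Real.sqrt_sq hx]

theorem eventually_nhdsWithin_zero_of_atTop {P : ℝ → Prop} (h : ∀ᶠ y in atTop, P y) :
    ∀ᶠ t : ℝ in 𝓝[Set.Icc 0 1] 0, t = 0 ∨ (0 < t ∧ P √(t⁻¹ - 1)) := by
  have h1 : Tendsto (fun t : ℝ => √(t⁻¹ - 1)) (𝓝[>] 0) atTop :=
    Real.tendsto_sqrt_atTop.comp
      (tendsto_atTop_add_const_right _ (-1) tendsto_inv_nhdsGT_zero)
  have h2 := h1.eventually h
  rw [eventually_nhdsWithin_iff] at h2 ⊢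
  filter_upwards [h2] with t ht htI
  rcases htI.1.eq_or_lt with h0 | h0
  · exact Or.inl h0.symm
  · exact Or.inr ⟨h0, ht h0⟩

theorem eventually_nhdsWithin_of_sqrt {P : ℝ → Prop} {x : ℝ} (hx : 0 < x)
    (h : ∀ᶠ y in 𝓝[Set.Ici 0] √(x⁻¹ - 1), P y) :
    ∀ᶠ t : ℝ in 𝓝[Set.Icc 0 1] x, 0 < t ∧ P √(t⁻¹ - 1) := by
  have hc : ContinuousAt (fun t : ℝ => √(t⁻¹ - 1)) x :=
    Real.continuous_sqrt.continuousAt.comp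
      ((continuousAt_inv₀ hx.ne').sub continuousAt_const)
  have h1 : Tendsto (fun t : ℝ => √(t⁻¹ - 1)) (𝓝 x) (𝓝[Set.Ici 0] √(x⁻¹ - 1)) :=
    tendsto_nhdsWithin_iff.2 ⟨hc, Eventually.of_forall fun t => Real.sqrt_nonneg _⟩
  exact nhdsWithin_le_nhds ((eventually_gt_nhds hx).and (h1.eventually h))

theorem sq_sqrt_inv_sub_one {t : ℝ} (h0 : 0 < t) (h1 : t ≤ 1) :
    t = (1 + √(t⁻¹ - 1) ^ 2)⁻¹ := by
  rw [Real.sq_sqrt (by linarith [(one_le_inv₀ h0).2 h1])]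
  simp

/-- With `t = 1 / (1 + y²)`, the quadratic equals `a' * (t - t₀) + R y * (t - t₀) ^ 2` exactly,
where `a'` is `a` times `dy/dt` at `y₀` and `R` is continuous at `y₀`. Lowering `R y` to the
constant `R y₀ - 1` gives the minorant. -/
theorem exists_minorant_change_of_variable {y₀ : ℝ} (hy₀ : 0 < y₀) (a K : ℝ) :
    ∃ a' K' : ℝ, ∀ᶠ y in 𝓝 y₀,
      a' * ((1 + y ^ 2)⁻¹ - (1 + y₀ ^ 2)⁻¹) - K' * ((1 + y ^ 2)⁻¹ - (1 + y₀ ^ 2)⁻¹) ^ 2 ≤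
        a * (y - y₀) - K * (y - y₀) ^ 2 := by
  set S : ℝ → ℝ := fun y => ((1 + y₀ ^ 2) * (1 + y ^ 2) / (y₀ + y)) ^ 2 with hS
  set R : ℝ → ℝ := fun y =>
    a * ((y₀ ^ 2 + 2 * y₀ * y - 1) / (2 * y₀ * (1 + y ^ 2))) * S y - K * S y with hR
  have hcont : ContinuousAt R y₀ := by
    have h1 : y₀ + y₀ ≠ 0 := by positivity
    have h2 : 2 * y₀ * (1 + y₀ ^ 2) ≠ 0 := by positivity
    simp only [hR, hS]
    fun_prop (disch := assumption)
  have hb : ∀ᶠ y in 𝓝 y₀, R y₀ - 1 < R y := hcont.eventually_const_lt (by linarith)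
  refine ⟨a * (-(1 + y₀ ^ 2) ^ 2 / (2 * y₀)), -(R y₀ - 1), ?_⟩
  filter_upwards [hb, eventually_gt_nhds hy₀] with y hy hy0
  have key : a * (y - y₀) - K * (y - y₀) ^ 2 =
      a * (-(1 + y₀ ^ 2) ^ 2 / (2 * y₀)) * ((1 + y ^ 2)⁻¹ - (1 + y₀ ^ 2)⁻¹) +
        R y * ((1 + y ^ 2)⁻¹ - (1 + y₀ ^ 2)⁻¹) ^ 2 := by
    have h1 : 1 + y ^ 2 ≠ 0 := by positivity
    have h2 : 1 + y₀ ^ 2 ≠ 0 := by positivity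
    have h3 : y₀ + y ≠ 0 := by positivity
    simp only [hR, hS]
    field_simp
    ring
  rw [key]
  nlinarith [sq_nonneg ((1 + y ^ 2)⁻¹ - (1 + y₀ ^ 2)⁻¹)]

theorem abs_freqCoord_sub_le (y z : ℝ) : |(1 + y ^ 2)⁻¹ - (1 + z ^ 2)⁻¹| ≤ |y - z| := by
  have h : (1 + y ^ 2)⁻¹ - (1 + z ^ 2)⁻¹ =
      (y - z) * (-(y + z) / ((1 + y ^ 2) * (1 + z ^ 2))) := by
    field_simp
    ring
  rw [h, abs_mul]
  refine mul_le_of_le_one_right (abs_nonneg _) ?_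
  rw [abs_div, abs_of_pos (by positivity : 0 < (1 + y ^ 2) * (1 + z ^ 2)),
    div_le_one (by positivity), abs_le]
  constructor <;> nlinarith [sq_nonneg (y + 1), sq_nonneg (y - 1), sq_nonneg (z + 1),
    sq_nonneg (z - 1), mul_nonneg (sq_nonneg y) (sq_nonneg z)]

/-- At the endpoints `t` is to first order linear in `ω²` or `ω⁻²`, so quadratic minorants without
linear term become linear ones in `t`. Zeros at finite frequencies keep their exponent since `t` is
1-Lipschitz in `ω`. -/
theorem IsRegularBound.isRegularOnIcc {γ : OnePoint ℝ → ℝ} (hγ : IsRegularBound γ) :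
    IsRegularOnIcc fun t => |γ (freqOfCoord t)| where
  nonneg t _ := abs_nonneg _
  minorant x hx hne := by
    simp only [ne_eq, abs_eq_zero] at hne
    rcases hx.1.eq_or_lt with rfl | hx0
    · simp only [freqOfCoord, if_true] at hne
      obtain ⟨K, hK⟩ := hγ.minorant_infty hne
      -- For `t ≤ 1 / 2`, `ω⁻² = t / (1 - t) ≤ 2 * t`.
      refine ⟨-(2 * |K|), 0, ?_⟩
      have hlt : ∀ᶠ t : ℝ in 𝓝[Set.Icc 0 1] 0, t < 1 / 2 :=
        nhdsWithin_le_nhds (eventually_lt_nhds (by norm_num))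
      filter_upwards [eventually_nhdsWithin_zero_of_atTop hK, hlt] with t ht ht2
      rcases ht with rfl | ⟨ht0, ht⟩
      · simp
      · simp only [freqOfCoord, if_true, if_neg ht0.ne']
        refine le_trans ?_ ht
        have h1 : (√(t⁻¹ - 1))⁻¹ ^ 2 ≤ 2 * t := by
          rw [inv_pow, Real.sq_sqrt (by linarith [(one_le_inv₀ ht0).2 (by linarith)])]
          have : t⁻¹ - 1 = (1 - t) / t := by field_simp
          rw [this, inv_div, div_le_iff₀ (by linarith)]
          nlinarith
        have h2 : K * (√(t⁻¹ - 1))⁻¹ ^ 2 ≤ |K| * (2 * t) :=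
          mul_le_mul (le_abs_self K) h1 (by positivity) (abs_nonneg K)
        linarith
    · have hfx : freqOfCoord x = ((√(x⁻¹ - 1) : ℝ) : OnePoint ℝ) := if_neg hx0.ne'
      have hcx := sq_sqrt_inv_sub_one hx0 hx.2
      rw [hfx] at hne
      rcases (Real.sqrt_nonneg (x⁻¹ - 1)).eq_or_lt with hy | hy
      · rw [← hy] at hne hcx
        obtain ⟨K, hK⟩ := hγ.minorant_zero hne
        -- For `t ≥ 1 / 2`, `ω² = (1 - t) / t ≤ 2 * (1 - t)`.
        refine ⟨2 * |K|, 0, ?_⟩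
        have hx1 : x = 1 := by simpa using hcx
        have hgt : ∀ᶠ t : ℝ in 𝓝[Set.Icc 0 1] x, 1 / 2 < t :=
          nhdsWithin_le_nhds (eventually_gt_nhds (by rw [hx1]; norm_num))
        have hK' : ∀ᶠ y : ℝ in 𝓝[≥] 0, |γ (0 : ℝ)| - K * y ^ 2 ≤ |γ y| := hK
        nth_rewrite 2 [hy] at hK'
        filter_upwards [eventually_nhdsWithin_of_sqrt hx0 hK', hgt, self_mem_nhdsWithin]
          with t ht ht2 htI
        rw [hfx, freqOfCoord, if_neg ht.1.ne']
        refine le_trans ?_ ht.2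
        have h1 : √(t⁻¹ - 1) ^ 2 ≤ 2 * (1 - t) := by
          rw [Real.sq_sqrt (by linarith [(one_le_inv₀ ht.1).2 htI.2])]
          have : t⁻¹ - 1 = (1 - t) / t := by field_simp
          rw [this, div_le_iff₀ ht.1]
          nlinarith [htI.2]
        have h2 : K * √(t⁻¹ - 1) ^ 2 ≤ |K| * (2 * (1 - t)) :=
          mul_le_mul (le_abs_self K) h1 (by positivity) (abs_nonneg K)
        rw [hx1] at *
        linarith
      · obtain ⟨a, K, hK⟩ := hγ.minorant_pos _ hy hne
        obtain ⟨a', K', hK'⟩ := exists_minorant_change_of_variable hy a K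
        refine ⟨a', K', ?_⟩
        filter_upwards [eventually_nhdsWithin_of_sqrt hx0 (nhdsWithin_le_nhds (hK.and hK')),
          self_mem_nhdsWithin] with t ht htI
        obtain ⟨ht0, h1, h2⟩ := ht
        rw [← hcx, ← sq_sqrt_inv_sub_one ht0 htI.2] at h2
        rw [hfx, freqOfCoord, if_neg ht0.ne']
        linarith
  finite_order x hx hzero := by
    rw [abs_eq_zero] at hzero
    rcases hx.1.eq_or_lt with rfl | hx0
    · have hf0 : freqOfCoord 0 = OnePoint.infty := if_pos rfl
      rw [hf0] at hzero
      obtain ⟨c, hc, k, hk⟩ := hγ.finite_order_infty hzero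
      -- a positive exponent, so that the bound also holds at infinity itself
      refine ⟨c, hc, k + 1, ?_⟩
      have hlt : ∀ᶠ t : ℝ in 𝓝[Set.Icc 0 1] 0, t < 1 :=
        nhdsWithin_le_nhds (eventually_lt_nhds one_pos)
      filter_upwards [eventually_nhdsWithin_zero_of_atTop hk, hlt] with t ht ht1
      rcases ht with rfl | ⟨ht0, ht⟩
      · simp
      · rw [freqOfCoord, if_neg ht0.ne', sub_zero, abs_of_pos ht0]
        refine le_trans ?_ ht
        have hy : 0 < √(t⁻¹ - 1) := Real.sqrt_pos.2 (by linarith [(one_lt_inv₀ ht0).2 ht1])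
        have h1 : t ≤ (√(t⁻¹ - 1))⁻¹ := by
          have h := inv_anti₀ hy (by nlinarith [sq_nonneg (√(t⁻¹ - 1) - 1)] :
            √(t⁻¹ - 1) ≤ 1 + √(t⁻¹ - 1) ^ 2)
          rwa [← sq_sqrt_inv_sub_one ht0 ht1.le] at h
        calc c * t ^ (k + 1) ≤ c * t ^ k :=
              mul_le_mul_of_nonneg_left (pow_le_pow_of_le_one ht0.le ht1.le (Nat.le_succ k)) hc.le
          _ ≤ c * (√(t⁻¹ - 1))⁻¹ ^ k := by gcongr
    · have hfx : freqOfCoord x = ((√(x⁻¹ - 1) : ℝ) : OnePoint ℝ) := if_neg hx0.ne'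
      rw [hfx] at hzero
      obtain ⟨c, hc, k, hk⟩ := hγ.finite_order _ (Real.sqrt_nonneg _) hzero
      refine ⟨c, hc, k, ?_⟩
      filter_upwards [eventually_nhdsWithin_of_sqrt hx0 hk, self_mem_nhdsWithin] with t ht htI
      rw [freqOfCoord, if_neg ht.1.ne']
      refine le_trans ?_ ht.2
      refine mul_le_mul_of_nonneg_left (pow_le_pow_left₀ (abs_nonneg _) ?_ k) hc.le
      have h := abs_freqCoord_sub_le √(t⁻¹ - 1) √(x⁻¹ - 1)
      rwa [← sq_sqrt_inv_sub_one ht.1 htI.2, ← sq_sqrt_inv_sub_one hx0 hx.2] at h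

/-! ### The largest singular value as operator norm -/

open scoped Matrix.Norms.L2Operator

theorem exists_unit_maxSingularValue {m : ℕ} (hm : 0 < m) (A : Matrix (Fin m) (Fin m) ℂ) :
    ∃ u : EuclideanSpace ℂ (Fin m), ‖u‖ = 1 ∧
      LinearMap.adjoint A.toEuclideanLin (A.toEuclideanLin u) =
        ((maxSingularValue A : ℂ) ^ 2) • u := by
  have h := A.toEuclideanLin.hasEigenvalue_adjoint_comp_self_sq_singularValues (n := 0)
    (by simpa using hm)
  obtain ⟨v, hv⟩ := h.exists_hasEigenvector
  have hv0 : ‖v‖ ≠ 0 := by simpa using hv.2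
  refine ⟨((‖v‖⁻¹ : ℝ) : ℂ) • v, ?_, ?_⟩
  · rw [norm_smul]
    simp [hv0]
  · have := hv.apply_eq_smul
    rw [LinearMap.comp_apply] at this
    rw [map_smul, map_smul, this, smul_comm]
    simp [maxSingularValue]

theorem maxSingularValue_nonneg {m : ℕ} (A : Matrix (Fin m) (Fin m) ℂ) :
    0 ≤ maxSingularValue A := LinearMap.singularValues_nonneg _ _

/-- Parseval in an eigenbasis of `T* T`, whose eigenvalues are the squared singular values. -/
theorem norm_toEuclideanLin_le {m : ℕ} (A : Matrix (Fin m) (Fin m) ℂ)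
    (x : EuclideanSpace ℂ (Fin m)) : ‖A.toEuclideanLin x‖ ≤ maxSingularValue A * ‖x‖ := by
  set T := A.toEuclideanLin with hT
  have hS := T.isSymmetric_adjoint_comp_self
  set b := hS.eigenvectorBasis (finrank_euclideanSpace_fin (𝕜 := ℂ) (n := m)) with hb
  refine le_of_sq_le_sq ?_ (mul_nonneg (maxSingularValue_nonneg A) (norm_nonneg x))
  have h1 : (‖T x‖ ^ 2 : ℝ) = RCLike.re (inner ℂ x ((LinearMap.adjoint T ∘ₗ T) x)) := by
    rw [LinearMap.comp_apply, LinearMap.adjoint_inner_right]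
    exact norm_sq_eq_re_inner (𝕜 := ℂ) _
  have h2 (i : Fin m) : hS.eigenvalues (finrank_euclideanSpace_fin (𝕜 := ℂ) (n := m)) i ≤
      maxSingularValue A ^ 2 := by
    rw [← T.sq_singularValues_fin]
    exact pow_le_pow_left₀ (T.singularValues_nonneg _) (T.singularValues_antitone (Nat.zero_le _)) 2
  have h3 (i : Fin m) : inner ℂ x (b i) * inner ℂ (b i) ((LinearMap.adjoint T ∘ₗ T) x) =
      ((hS.eigenvalues (finrank_euclideanSpace_fin (𝕜 := ℂ) (n := m)) i * ‖inner ℂ (b i) x‖ ^ 2 :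
        ℝ) : ℂ) := by
    have := hS.eigenvectorBasis_apply_self_apply (finrank_euclideanSpace_fin (𝕜 := ℂ) (n := m)) x i
    rw [OrthonormalBasis.repr_apply_apply, OrthonormalBasis.repr_apply_apply] at this
    rw [this, ← inner_conj_symm x]
    push_cast
    rw [← Complex.conj_mul']
    ring!
  rw [h1, ← b.sum_inner_mul_inner, Finset.sum_congr rfl fun i _ => h3 i, ← Complex.ofReal_sum,
    RCLike.re_to_complex, Complex.ofReal_re, mul_pow, ← b.sum_sq_norm_inner_right x,
    Finset.mul_sum]
  gcongr with i
  exact h2 i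

/-- The largest singular value is the operator norm. -/
theorem maxSingularValue_eq_norm {m : ℕ} (A : Matrix (Fin m) (Fin m) ℂ) :
    maxSingularValue A = ‖A‖ := by
  apply le_antisymm
  · rcases m.eq_zero_or_pos with rfl | hm
    · rw [maxSingularValue, LinearMap.singularValues_of_finrank_le _ (by simp)]
      exact norm_nonneg A
    · obtain ⟨u, hu, hAu⟩ := exists_unit_maxSingularValue hm A
      have h1 : ‖A.toEuclideanLin u‖ ^ 2 = maxSingularValue A ^ 2 := by
        have : (‖A.toEuclideanLin u‖ ^ 2 : ℝ) = RCLike.re (inner ℂ u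
            (LinearMap.adjoint A.toEuclideanLin (A.toEuclideanLin u))) := by
          rw [LinearMap.adjoint_inner_right]
          exact norm_sq_eq_re_inner (𝕜 := ℂ) _
        rw [this, hAu, inner_smul_right, inner_self_eq_norm_sq_to_K, hu]
        rw [RCLike.ofReal_one, one_pow, mul_one, ← Complex.ofReal_pow]
        exact Complex.ofReal_re _
      have h2 : ‖A.toEuclideanLin u‖ = maxSingularValue A :=
        (sq_eq_sq₀ (norm_nonneg _) (maxSingularValue_nonneg A)).1 h1
      have h3 := Matrix.l2_opNorm_mulVec A u
      rw [hu, mul_one] at h3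
      rw [← h2]
      exact h3
  · rw [Matrix.l2_opNorm_def]
    exact ContinuousLinearMap.opNorm_le_bound _ (maxSingularValue_nonneg A)
      (norm_toEuclideanLin_le A)

theorem det_one_add_ne_zero_of_norm_lt_one {m : ℕ} {A : Matrix (Fin m) (Fin m) ℂ} (hA : ‖A‖ < 1) :
    (1 + A).det ≠ 0 := by
  intro h
  obtain ⟨v, hv, hAv⟩ := Matrix.exists_mulVec_eq_zero_iff.2 h
  rw [Matrix.add_mulVec, Matrix.one_mulVec] at hAv
  have h1 := Matrix.l2_opNorm_mulVec A (WithLp.toLp 2 v)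
  have h2 : (WithLp.toLp 2 (A.mulVec v) : EuclideanSpace ℂ (Fin m)) = -WithLp.toLp 2 v := by
    rw [← WithLp.toLp_neg, ← eq_neg_of_add_eq_zero_right hAv]
  have h3 : 0 < ‖(WithLp.toLp 2 v : EuclideanSpace ℂ (Fin m))‖ := by
    rw [norm_pos_iff]
    simpa using hv
  change ‖(WithLp.toLp 2 (A.mulVec v) : EuclideanSpace ℂ (Fin m))‖ ≤ _ at h1
  rw [h2, norm_neg] at h1
  nlinarith

/-! ### Sufficiency: the small gain theorem -/

theorem tendsto_matrix_eval_cobounded {m : ℕ} (M : Matrix (Fin m) (Fin m) rhInfty) :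
    Tendsto (fun s : ℂ => M.map fun r => RatFunc.eval (algebraMap ℝ ℂ) s (r : RatFunc ℝ))
      (Bornology.cobounded ℂ) (𝓝 (M.map evalInfty)) := by
  refine tendsto_pi_nhds.2 fun i => tendsto_pi_nhds.2 fun j => ?_
  exact tendsto_eval_cobounded (M i j).2.1

theorem continuousOn_matrix_eval {m : ℕ} (M : Matrix (Fin m) (Fin m) rhInfty) :
    ContinuousOn (fun s : ℂ => M.map fun r => RatFunc.eval (algebraMap ℝ ℂ) s (r : RatFunc ℝ))
      {s | 0 ≤ s.re} := by
  refine continuousOn_pi.2 fun i => continuousOn_pi.2 fun j => ?_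
  exact continuousOn_evalAt (M i j)

theorem differentiableOn_matrix_eval {m : ℕ} (M : Matrix (Fin m) (Fin m) rhInfty) :
    DifferentiableOn ℂ
      (fun s : ℂ => M.map fun r => RatFunc.eval (algebraMap ℝ ℂ) s (r : RatFunc ℝ))
      {s | 0 ≤ s.re} := by
  have h : (fun s : ℂ => M.map fun r => RatFunc.eval (algebraMap ℝ ℂ) s (r : RatFunc ℝ)) =
      fun s => ∑ i, ∑ j, RatFunc.eval (algebraMap ℝ ℂ) s (M i j : RatFunc ℝ) •
        Matrix.single i j (1 : ℂ) := by
    funext s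
    conv_lhs => rw [Matrix.matrix_eq_sum_single (M.map _)]
    simp [Matrix.smul_single]
  rw [h]
  exact DifferentiableOn.fun_sum fun i _ => DifferentiableOn.fun_sum fun j _ =>
    (differentiableOn_evalAt (M i j)).smul_const _

/-- The small gain theorem: a stable loop transfer matrix of norm less than one on the
imaginary axis and at infinity gives a stable inverse of `1 + M`. -/
theorem isUnit_one_add_of_norm_lt_one {m : ℕ} (M : Matrix (Fin m) (Fin m) rhInfty)
    (h : ∀ ω, ‖M.map (evalFreq ω)‖ < 1) : IsUnit (1 + M) := by
  set f : ℂ → Matrix (Fin m) (Fin m) ℂ :=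
    fun s => M.map fun r => RatFunc.eval (algebraMap ℝ ℂ) s (r : RatFunc ℝ) with hf
  have hlim : Tendsto f (Bornology.cobounded ℂ) (𝓝 (M.map evalInfty)) :=
    tendsto_matrix_eval_cobounded M
  have hinf : ‖M.map evalInfty‖ < 1 := h OnePoint.infty
  have haxis (x : ℝ) : ‖f (x * Complex.I)‖ < 1 := by
    rw [mul_comm]
    exact h x
  have hline : Tendsto (fun x : ℝ => (x : ℂ) * Complex.I) (cocompact ℝ)
      (Bornology.cobounded ℂ) := by
    rw [← tendsto_norm_atTop_iff_cobounded]
    simpa only [norm_mul, Complex.norm_real, Complex.norm_I, mul_one] using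
      tendsto_norm_cocompact_atTop (E := ℝ)
  -- The pointwise strict bound becomes uniform: the limit at infinity controls the axis outside a
  -- compact set, and a maximum is attained on that set.
  obtain ⟨C, hC1, hC⟩ : ∃ C < 1, ∀ x : ℝ, ‖f (x * Complex.I)‖ ≤ C := by
    obtain ⟨q, hq, hq1⟩ := exists_between hinf
    obtain ⟨K, hK, hKq⟩ := mem_cocompact.1
      (((hlim.comp hline).norm).eventually_lt_const hq)
    have hcont : Continuous fun x : ℝ => ‖f (x * Complex.I)‖ :=
      ((continuousOn_matrix_eval M).comp_continuous (by fun_prop) (by simp)).norm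
    obtain ⟨x₀, -, hx₀⟩ := (hK.insert 0).exists_isMaxOn (Set.insert_nonempty 0 K)
      hcont.continuousOn
    refine ⟨max q ‖f (x₀ * Complex.I)‖, max_lt hq1 (haxis x₀), fun x => ?_⟩
    by_cases hx : x ∈ K
    · exact (hx₀ (Set.mem_insert_of_mem 0 hx)).trans (le_max_right _ _)
    · exact (hKq hx).le.trans (le_max_left _ _)
  have hbound (s : ℂ) (hs : 0 ≤ s.re) : ‖f s‖ ≤ C := by
    have hcl : closure {s : ℂ | 0 < s.re} = {s | 0 ≤ s.re} := Complex.closure_setOfPred_lt_re 0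
    -- The growth conditions hold because `f` converges at infinity.
    refine PhragmenLindelof.right_half_plane_of_bounded_on_real ⟨?_, ?_⟩ ⟨1, by norm_num, 0, ?_⟩
      ?_ hC hs
    · exact (differentiableOn_matrix_eval M).mono fun s (hs : 0 < s.re) => hs.le
    · rw [hcl]
      exact continuousOn_matrix_eval M
    · simp only [zero_mul, Real.exp_zero]
      exact (hlim.isBigO_one ℝ).mono inf_le_left
    · have hreal : Tendsto (fun x : ℝ => (x : ℂ)) atTop (Bornology.cobounded ℂ) := by
        rw [← tendsto_norm_atTop_iff_cobounded]
        simpa using tendsto_abs_atTop_atTop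
      exact ((hlim.comp hreal).norm).isBoundedUnder_le
  refine isUnit_matrix_rhInfty (fun s hs => ?_) ?_
  · have : (1 + M).map (evalAt s hs) = 1 + f s := by
      change (evalAt s hs).mapMatrix (1 + M) = _
      rw [map_add, map_one]
      rfl
    rw [this]
    exact det_one_add_ne_zero_of_norm_lt_one ((hbound s hs).trans_lt hC1)
  · have : (1 + M).map evalInfty = 1 + M.map evalInfty := by
      change evalInfty.mapMatrix (1 + M) = _
      rw [map_add, map_one]
      rfl
    rw [this]
    exact det_one_add_ne_zero_of_norm_lt_one hinf

theorem evalFreq_neg (x : ℝ) (r : rhInfty) :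
    evalFreq ((-x : ℝ) : OnePoint ℝ) r = starRingEnd ℂ (evalFreq (x : OnePoint ℝ) r) := by
  rw [evalFreq_coe, evalFreq_coe, evalAt_apply, evalAt_apply, ← evalAt_conj]
  simp

/-- Real coefficients and symmetry give `M(-jω) = M(jω)ᴴ`; thus bounds on `[0, ∞]` extend to the
whole axis. -/
theorem norm_map_evalFreq_neg {m : ℕ} {M : Matrix (Fin m) (Fin m) rhInfty} (hM : M.transpose = M)
    (x : ℝ) : ‖M.map (evalFreq ((-x : ℝ) : OnePoint ℝ))‖ =
      ‖M.map (evalFreq (x : OnePoint ℝ))‖ := by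
  rw [← Matrix.l2_opNorm_conjTranspose (M.map (evalFreq (x : OnePoint ℝ)))]
  congr 1
  ext i j
  rw [Matrix.conjTranspose_apply, Matrix.map_apply, Matrix.map_apply, evalFreq_neg,
    ← Matrix.transpose_apply M, hM]
  rfl

theorem coe_mem_frequencies {x : ℝ} (hx : 0 ≤ x) : (x : OnePoint ℝ) ∈ frequencies :=
  Or.inr ⟨x, hx, rfl⟩

theorem norm_map_evalFreq_mul_lt_one {m : ℕ} {G H : Matrix (Fin m) (Fin m) rhInfty}
    (hG : G.transpose = G) (hH : H.transpose = H)
    (h : ∀ ω ∈ frequencies, ‖G.map (evalFreq ω)‖ * ‖H.map (evalFreq ω)‖ < 1) (ω : OnePoint ℝ) :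
    ‖(G * H).map (evalFreq ω)‖ < 1 := by
  have hmul : (G * H).map (evalFreq ω) = G.map (evalFreq ω) * H.map (evalFreq ω) :=
    map_mul (evalFreq ω).mapMatrix G H
  rw [hmul]
  refine (Matrix.l2_opNorm_mul _ _).trans_lt ?_
  induction ω using OnePoint.rec with
  | infty => exact h _ (Or.inl rfl)
  | coe x =>
    rcases le_total 0 x with hx | hx
    · exact h _ (coe_mem_frequencies hx)
    · have := h _ (coe_mem_frequencies (neg_nonneg.2 hx))
      rwa [norm_map_evalFreq_neg hG, norm_map_evalFreq_neg hH] at this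

theorem mul_lt_one_of_ofReal_lt_inv {a b c : ℝ} (ha : 0 ≤ a) (hc : 0 ≤ c) (hcb : c ≤ b)
    (h : ENNReal.ofReal a < (ENNReal.ofReal b)⁻¹) : a * c < 1 := by
  rcases hc.eq_or_lt with rfl | hc0
  · simp
  have hb := hc0.trans_le hcb
  rw [← ENNReal.ofReal_inv_of_pos hb, ENNReal.ofReal_lt_ofReal_iff (inv_pos.2 hb)] at h
  calc a * c ≤ a * b := by gcongr
    _ < b⁻¹ * b := by gcongr
    _ = 1 := inv_mul_cancel₀ hb.ne'

theorem feedbackStable_of_smallGainCondition {m : ℕ} {G : Matrix (Fin m) (Fin m) (RatFunc ℝ)}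
    (hG : IsRHInfty G) (hGsymm : G.transpose = G) {γ : OnePoint ℝ → ℝ}
    (h : SmallGainCondition G γ) {H : Matrix (Fin m) (Fin m) (RatFunc ℝ)}
    (hH : H ∈ symmBall m γ) : FeedbackStable G H := by
  obtain ⟨⟨hH, hHγ⟩, hHsymm⟩ := hH
  obtain ⟨G, rfl⟩ := hG.exists_lift
  obtain ⟨H, rfl⟩ := hH.exists_lift
  have hsymm {M : Matrix (Fin m) (Fin m) rhInfty}
      (hM : (M.map Subtype.val).transpose = M.map Subtype.val) : M.transpose = M :=
    Matrix.map_injective Subtype.val_injective hM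
  rw [feedbackStable_iff]
  refine isUnit_one_add_of_norm_lt_one _
    (norm_map_evalFreq_mul_lt_one (hsymm hGsymm) (hsymm hHsymm) fun ω hω => ?_)
  have h1 := h ω hω
  have h2 := hHγ ω hω
  rw [freqResponse_map, maxSingularValue_eq_norm] at h1 h2
  exact mul_lt_one_of_ofReal_lt_inv (norm_nonneg _) (norm_nonneg _) h2 h1

/-! ### Scalar transfer functions with prescribed gain -/

/-- A real constant as a stable transfer function. -/
def rhConst (c : ℝ) : rhInfty :=
  ⟨RatFunc.C c, by simp [IsProper], by simp [PolesInOpenLeftHalfPlane]⟩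

theorem evalFreq_rhConst (ω : OnePoint ℝ) (c : ℝ) : evalFreq ω (rhConst c) = c := by
  induction ω using OnePoint.rec with
  | infty => simp [evalFreq_infty, evalInfty_apply, valueAtInfty, rhConst]
  | coe x => simp [evalFreq_coe, evalAt_apply, rhConst]

/-- The first order lag `1 / (s + a)`. -/
def rhLag (a : ℝ) (ha : 0 < a) : rhInfty :=
  ⟨(algebraMap (Polynomial ℝ) (RatFunc ℝ) (Polynomial.X + Polynomial.C a))⁻¹, by
    constructor
    · rw [isProper_iff_intDegree_nonpos, RatFunc.intDegree_inv, RatFunc.intDegree_polynomial]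
      simp
    · have hne : algebraMap (Polynomial ℝ) (RatFunc ℝ) (Polynomial.X + Polynomial.C a) ≠ 0 :=
        RatFunc.algebraMap_ne_zero (Polynomial.X_add_C_ne_zero a)
      have hdvd := RatFunc.denom_inv_dvd hne
      rw [RatFunc.num_algebraMap] at hdvd
      refine polesInOpenLeftHalfPlane_of_dvd hdvd fun s hs h0 => ?_
      have h1 := congrArg Complex.re h0
      simp at h1
      linarith⟩

theorem evalAt_rhLag (a : ℝ) (ha : 0 < a) (s : ℂ) (hs : 0 ≤ s.re) :
    evalAt s hs (rhLag a ha) = (s + a)⁻¹ := by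
  set p : RatFunc ℝ := algebraMap (Polynomial ℝ) (RatFunc ℝ) (Polynomial.X + Polynomial.C a)
    with hp
  have hne : p ≠ 0 := RatFunc.algebraMap_ne_zero (Polynomial.X_add_C_ne_zero a)
  have h := RatFunc.eval_mul (algebraMap ℝ ℂ) s (x := p) (y := (rhLag a ha : RatFunc ℝ))
    (by rw [hp, RatFunc.denom_algebraMap]; simp) ((rhLag a ha).2.2.eval₂_denom_ne_zero hs)
  have h1 : p * (rhLag a ha : RatFunc ℝ) = 1 := mul_inv_cancel₀ hne
  have h2 : RatFunc.eval (algebraMap ℝ ℂ) s p = s + a := by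
    rw [hp, RatFunc.eval_algebraMap]
    simp
  rw [h1, RatFunc.eval_one, h2] at h
  exact eq_inv_of_mul_eq_one_right h.symm

theorem evalFreq_infty_rhLag (a : ℝ) (ha : 0 < a) : evalFreq OnePoint.infty (rhLag a ha) = 0 := by
  rw [evalFreq_infty, evalInfty_apply]
  refine tendsto_nhds_unique (tendsto_eval_ofReal_atTop (rhLag a ha).2.1) ?_
  have h : Tendsto (fun x : ℝ => (((x + a)⁻¹ : ℝ) : ℂ)) atTop (𝓝 ((0 : ℝ) : ℂ)) :=
    (Complex.continuous_ofReal.tendsto 0).comp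
      (tendsto_inv_atTop_zero.comp (tendsto_atTop_add_const_right _ a tendsto_id))
  refine (h.congr' ?_).trans (by simp)
  filter_upwards [eventually_ge_atTop 0] with x hx
  have := evalAt_rhLag a ha x (by simpa using hx)
  rw [evalAt_apply] at this
  rw [this]
  push_cast
  rfl

theorem evalFreq_coe_rhLag (a : ℝ) (ha : 0 < a) (x : ℝ) :
    evalFreq (x : OnePoint ℝ) (rhLag a ha) = (Complex.I * x + a)⁻¹ :=
  evalAt_rhLag a ha (Complex.I * x) (by simp)

theorem I_mul_add_ne_zero {a : ℝ} (ha : 0 < a) (x : ℝ) : Complex.I * x + a ≠ 0 := by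
  intro h
  have h1 := congrArg Complex.re h
  simp at h1
  linarith

/-- The first order all-pass `(s - a) / (s + a)`. -/
def rhAllPass (a : ℝ) (ha : 0 < a) : rhInfty := 1 - rhConst (2 * a) * rhLag a ha

theorem evalFreq_coe_rhAllPass (a : ℝ) (ha : 0 < a) (x : ℝ) :
    evalFreq (x : OnePoint ℝ) (rhAllPass a ha) = (Complex.I * x - a) / (Complex.I * x + a) := by
  have h := I_mul_add_ne_zero ha x
  rw [rhAllPass, map_sub, map_one, map_mul, evalFreq_rhConst, evalFreq_coe_rhLag]
  field_simp
  push_cast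
  ring

theorem evalFreq_infty_rhAllPass (a : ℝ) (ha : 0 < a) :
    evalFreq OnePoint.infty (rhAllPass a ha) = 1 := by
  rw [rhAllPass, map_sub, map_one, map_mul, evalFreq_infty_rhLag, mul_zero, sub_zero]

theorem norm_evalFreq_rhAllPass (a : ℝ) (ha : 0 < a) (ω : OnePoint ℝ) :
    ‖evalFreq ω (rhAllPass a ha)‖ = 1 := by
  induction ω using OnePoint.rec with
  | infty => rw [evalFreq_infty_rhAllPass, norm_one]
  | coe x =>
    have h : Complex.I * x - a = -(starRingEnd ℂ (Complex.I * x + a)) := by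
      simp
      ring
    rw [evalFreq_coe_rhAllPass, norm_div, h, norm_neg, Complex.norm_conj,
      div_self (norm_ne_zero_iff.2 (I_mul_add_ne_zero ha x))]

/-- A stable transfer function of constant gain with a prescribed value at a positive frequency. -/
theorem exists_constant_gain_interpolant {x : ℝ} (hx : 0 < x) (ξ : ℂ) :
    ∃ f : rhInfty, evalFreq (x : OnePoint ℝ) f = ξ ∧ ∀ ω, ‖evalFreq ω f‖ = ‖ξ‖ := by
  have main (ξ : ℂ) (hξ : 0 < ξ.im) :
      ∃ f : rhInfty, evalFreq (x : OnePoint ℝ) f = ξ ∧ ∀ ω, ‖evalFreq ω f‖ = ‖ξ‖ := by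
    have hρ : 0 < ‖ξ‖ + ξ.re := by
      have h1 := Complex.abs_re_lt_norm.2 hξ.ne'
      linarith [neg_abs_le ξ.re]
    -- This is `x * tan (arg ξ / 2)`. As `a` ranges over the positive reals, the all-pass value at
    -- `jx` sweeps the open upper unit semicircle; the lower one is reached by a sign change.
    set a := x * ξ.im / (‖ξ‖ + ξ.re) with ha
    have ha0 : 0 < a := by positivity
    refine ⟨rhConst ‖ξ‖ * rhAllPass a ha0, ?_, fun ω => ?_⟩
    · rw [map_mul, evalFreq_rhConst, evalFreq_coe_rhAllPass, mul_div_assoc',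
        div_eq_iff (I_mul_add_ne_zero ha0 x)]
      have hsq : ‖ξ‖ ^ 2 = ξ.re ^ 2 + ξ.im ^ 2 := by
        rw [Complex.sq_norm, Complex.normSq_apply]
        ring
      have hkey : a * (‖ξ‖ + ξ.re) = x * ξ.im := div_mul_cancel₀ _ hρ.ne'
      apply Complex.ext
      · simp only [Complex.mul_re, Complex.mul_im, Complex.add_re, Complex.add_im, Complex.sub_re,
          Complex.sub_im, Complex.ofReal_re, Complex.ofReal_im, Complex.I_re, Complex.I_im]
        linear_combination -hkey
      · simp only [Complex.mul_re, Complex.mul_im, Complex.add_re, Complex.add_im, Complex.sub_re,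
          Complex.sub_im, Complex.ofReal_re, Complex.ofReal_im, Complex.I_re, Complex.I_im]
        refine mul_left_cancel₀ hρ.ne' ?_
        linear_combination x * hsq - ξ.im * hkey
    · rw [map_mul, evalFreq_rhConst, norm_mul, norm_evalFreq_rhAllPass, mul_one]
      simp
  rcases lt_trichotomy ξ.im 0 with h | h | h
  · obtain ⟨f, hf, hf'⟩ := main (-ξ) (by simpa using h)
    exact ⟨-f, by rw [map_neg, hf, neg_neg], fun ω => by rw [map_neg, norm_neg, hf', norm_neg]⟩
  · have hξ : ((ξ.re : ℝ) : ℂ) = ξ := Complex.ext rfl (by simp [h])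
    exact ⟨rhConst ξ.re, by rw [evalFreq_rhConst, hξ], fun ω => by rw [evalFreq_rhConst, hξ]⟩
  · exact main ξ h

/-- Every polynomial in `1 / (1 + ω²)` is, up to sign, the gain of a stable transfer function. -/
theorem exists_norm_evalFreq_eq_abs_eval (Q : Polynomial ℝ) :
    ∃ e : rhInfty, ∀ ω, ‖evalFreq ω e‖ = |Q.eval (freqCoord ω)| := by
  -- On the axis `|α| = 1` and `β = t * α` with `t` the frequency coordinate, so homogenizing `Q` in
  -- `α` and `β` yields `α ^ deg Q * Q(t)`.
  set α : rhInfty := -rhAllPass 1 one_pos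
  set β : rhInfty := rhLag 1 one_pos ^ 2
  have hα (ω : OnePoint ℝ) : ‖evalFreq ω α‖ = 1 := by
    rw [map_neg, norm_neg, norm_evalFreq_rhAllPass]
  have hβ (ω : OnePoint ℝ) : evalFreq ω β = freqCoord ω * evalFreq ω α := by
    induction ω using OnePoint.rec with
    | infty => simp [β, freqCoord_infty, evalFreq_infty_rhLag]
    | coe x =>
      rw [map_neg, map_pow, evalFreq_coe_rhAllPass, evalFreq_coe_rhLag, freqCoord_coe]
      have h := I_mul_add_ne_zero one_pos x
      have h' : (1 + (x : ℂ) ^ 2) ≠ 0 := by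
        norm_cast
        positivity
      push_cast at h ⊢
      field_simp
      linear_combination (x : ℂ) ^ 2 * Complex.I_sq
  refine ⟨∑ i ∈ Finset.range (Q.natDegree + 1),
    rhConst (Q.coeff i) * α ^ (Q.natDegree - i) * β ^ i, fun ω => ?_⟩
  have h : evalFreq ω (∑ i ∈ Finset.range (Q.natDegree + 1),
      rhConst (Q.coeff i) * α ^ (Q.natDegree - i) * β ^ i) =
      evalFreq ω α ^ Q.natDegree * ((Q.eval (freqCoord ω) : ℝ) : ℂ) := by
    rw [Polynomial.eval_eq_sum_range, map_sum, Complex.ofReal_sum, Finset.mul_sum]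
    refine Finset.sum_congr rfl fun i hi => ?_
    have hi' : i ≤ Q.natDegree := Nat.lt_succ_iff.1 (Finset.mem_range.1 hi)
    rw [map_mul, map_mul, map_pow, map_pow, evalFreq_rhConst, hβ, mul_pow,
      ← pow_sub_mul_pow (evalFreq ω α) hi']
    push_cast
    ring
  rw [h, norm_mul, norm_pow, hα, one_pow, one_mul, Complex.norm_real, Real.norm_eq_abs]

/-! ### Necessity: Takagi vectors and rank-one destabilization -/

open Matrix
open scoped ComplexConjugate

theorem mulVec_star_of_transpose_eq {m : ℕ} {A : Matrix (Fin m) (Fin m) ℂ} (hA : Aᵀ = A)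
    (v : Fin m → ℂ) : A *ᵥ star v = star (Aᴴ *ᵥ v) := by
  rw [star_mulVec, conjTranspose_conjTranspose, ← mulVec_transpose, hA]

theorem exists_normalize {m : ℕ} {v : Fin m → ℂ} (hv : v ≠ 0) :
    ∃ r : ℝ, ∑ i, ‖((r : ℂ) • v) i‖ ^ 2 = 1 := by
  have h : 0 < ∑ i, ‖v i‖ ^ 2 := by
    obtain ⟨i, hi⟩ := Function.ne_iff.1 hv
    exact Finset.sum_pos' (fun i _ => by positivity)
      ⟨i, Finset.mem_univ i, pow_pos (norm_pos_iff.2 hi) 2⟩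
  refine ⟨(√(∑ i, ‖v i‖ ^ 2))⁻¹, ?_⟩
  simp only [Pi.smul_apply, smul_eq_mul, norm_mul, mul_pow, ← Finset.mul_sum]
  rw [Complex.norm_real, Real.norm_eq_abs, sq_abs, inv_pow, Real.sq_sqrt h.le,
    inv_mul_cancel₀ h.ne']

/-- The leading Takagi vector of a complex symmetric matrix. -/
theorem exists_takagi_ne_zero {m : ℕ} (hm : 0 < m) {A : Matrix (Fin m) (Fin m) ℂ} (hA : Aᵀ = A) :
    ∃ v : Fin m → ℂ, v ≠ 0 ∧ A *ᵥ v = (maxSingularValue A : ℂ) • star v := by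
  obtain ⟨u, hu, hAu⟩ := exists_unit_maxSingularValue hm A
  set σ : ℂ := (maxSingularValue A : ℂ) with hσ
  have hσr : star σ = σ := Complex.conj_ofReal _
  have hu0 : u.ofLp ≠ 0 := by
    intro h
    have : u = 0 := by
      ext i
      exact congrFun h i
    simp [this] at hu
  have hAu' : Aᴴ *ᵥ (A *ᵥ u.ofLp) = σ ^ 2 • u.ofLp := by
    rw [← toEuclideanLin_conjTranspose_eq_adjoint] at hAu
    exact congrArg WithLp.ofLp hAu
  -- Symmetrizing the singular vector `u` gives a Takagi vector unless the sum vanishes; then `A u =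
  -- -σ ū`, and `i u` is one.
  by_cases hv : star (A *ᵥ u.ofLp) + σ • u.ofLp = 0
  · refine ⟨Complex.I • u.ofLp, smul_ne_zero Complex.I_ne_zero hu0, ?_⟩
    have h1 : A *ᵥ u.ofLp = -(σ • star u.ofLp) := by
      rw [← star_star (A *ᵥ u.ofLp), eq_neg_of_add_eq_zero_left hv, star_neg, star_smul, hσr]
    rw [mulVec_smul, h1, star_smul, Complex.star_def, Complex.conj_I, smul_neg, neg_smul,
      smul_neg, smul_comm]
  · refine ⟨_, hv, ?_⟩
    rw [mulVec_add, mulVec_smul, mulVec_star_of_transpose_eq hA, hAu', star_add, star_star,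
      star_smul, star_smul, star_pow, hσr, smul_add, smul_smul, add_comm, sq]

theorem exists_takagi {m : ℕ} (hm : 0 < m) {A : Matrix (Fin m) (Fin m) ℂ} (hA : Aᵀ = A) :
    ∃ v : Fin m → ℂ, ∑ i, ‖v i‖ ^ 2 = 1 ∧ A *ᵥ v = (maxSingularValue A : ℂ) • star v := by
  obtain ⟨v, hv, hAv⟩ := exists_takagi_ne_zero hm hA
  obtain ⟨r, hr⟩ := exists_normalize hv
  refine ⟨_, hr, ?_⟩
  rw [mulVec_smul, hAv, star_smul, Complex.star_def, Complex.conj_ofReal, smul_comm]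

/-- Needed at `0` and `∞`, where transfer functions take only real values. For a Takagi vector `v`,
the real vector `v + v̄` has eigenvalue `σ`; if it vanishes, `i v` is real with eigenvalue `-σ`. -/
theorem exists_real_eigenvector {m : ℕ} (hm : 0 < m) {A : Matrix (Fin m) (Fin m) ℂ} (hA : Aᵀ = A)
    (hreal : Aᴴ = A) :
    ∃ v : Fin m → ℂ, star v = v ∧ ∑ i, ‖v i‖ ^ 2 = 1 ∧ ∃ ε : ℝ, |ε| = 1 ∧
      A *ᵥ v = ((ε * maxSingularValue A : ℝ) : ℂ) • v := by
  suffices H : ∃ v : Fin m → ℂ, v ≠ 0 ∧ star v = v ∧ ∃ ε : ℝ, |ε| = 1 ∧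
      A *ᵥ v = ((ε * maxSingularValue A : ℝ) : ℂ) • v by
    obtain ⟨v, hv, hvr, ε, hε, hAv⟩ := H
    obtain ⟨r, hr⟩ := exists_normalize hv
    refine ⟨_, ?_, hr, ε, hε, ?_⟩
    · rw [star_smul, hvr, Complex.star_def, Complex.conj_ofReal]
    · rw [mulVec_smul, hAv, smul_comm]
  obtain ⟨v, hv, hAv⟩ := exists_takagi_ne_zero hm hA
  have hstar : A *ᵥ star v = (maxSingularValue A : ℂ) • v := by
    rw [mulVec_star_of_transpose_eq hA, hreal, hAv, star_smul, star_star, Complex.star_def,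
      Complex.conj_ofReal]
  by_cases h : v + star v = 0
  · have hs : star v = -v := eq_neg_of_add_eq_zero_right h
    refine ⟨Complex.I • v, smul_ne_zero Complex.I_ne_zero hv, ?_, -1, by simp, ?_⟩
    · rw [star_smul, hs, Complex.star_def, Complex.conj_I, smul_neg, neg_smul, neg_neg]
    · rw [mulVec_smul, hAv, hs, smul_neg, smul_neg, smul_comm]
      simp
  · refine ⟨v + star v, h, by rw [star_add, star_star, add_comm], 1, by simp, ?_⟩
    rw [mulVec_add, hAv, hstar, one_mul, smul_add, add_comm]

theorem norm_smul_vecMulVec_le {m : ℕ} (c : ℂ) {v : Fin m → ℂ} (hv : ∑ i, ‖v i‖ ^ 2 = 1) :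
    ‖c • vecMulVec v v‖ ≤ ‖c‖ := by
  have hn : ‖(WithLp.toLp 2 v : EuclideanSpace ℂ (Fin m))‖ = 1 := by
    rw [EuclideanSpace.norm_eq]
    simp [hv]
  have hns : ‖(WithLp.toLp 2 (star v) : EuclideanSpace ℂ (Fin m))‖ = 1 := by
    rw [EuclideanSpace.norm_eq]
    simp [hv]
  rw [norm_smul]
  refine mul_le_of_le_one_right (norm_nonneg c) ?_
  rw [l2_opNorm_def]
  refine ContinuousLinearMap.opNorm_le_bound _ zero_le_one fun x => ?_
  have h1 : (vecMulVec v v).toEuclideanLin x =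
      (v ⬝ᵥ x.ofLp) • (WithLp.toLp 2 v : EuclideanSpace ℂ (Fin m)) := by
    ext i
    change (vecMulVec v v *ᵥ x.ofLp) i = _
    rw [vecMulVec_mulVec]
    simp [mul_comm]
  have h2 : v ⬝ᵥ x.ofLp = inner ℂ (WithLp.toLp 2 (star v) : EuclideanSpace ℂ (Fin m)) x := by
    simp [EuclideanSpace.inner_eq_star_dotProduct, dotProduct_comm]
  change ‖(vecMulVec v v).toEuclideanLin x‖ ≤ _
  rw [h1, norm_smul, hn, mul_one, h2]
  simpa [hns] using norm_inner_le_norm (𝕜 := ℂ)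
    (WithLp.toLp 2 (star v) : EuclideanSpace ℂ (Fin m)) x

theorem not_isUnit_one_add_mul {m : ℕ} {G H : Matrix (Fin m) (Fin m) rhInfty} (ω : OnePoint ℝ)
    {v : Fin m → ℂ} (hv : v ≠ 0)
    (h : G.map (evalFreq ω) *ᵥ (H.map (evalFreq ω) *ᵥ v) = -v) : ¬ IsUnit (1 + G * H) := by
  intro hu
  have hu' := hu.map (evalFreq ω).mapMatrix
  rw [map_add, map_one, map_mul, isUnit_iff_isUnit_det, isUnit_iff_ne_zero] at hu'
  refine hu' (exists_mulVec_eq_zero_iff.1 ⟨v, hv, ?_⟩)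
  rw [add_mulVec, one_mulVec, ← mulVec_mulVec]
  change v + G.map (evalFreq ω) *ᵥ (H.map (evalFreq ω) *ᵥ v) = 0
  rw [h, add_neg_cancel]

/-- A rank one symmetric perturbation `h w wᵀ` in the ball which destabilizes the loop. -/
theorem exists_mem_symmBall_not_feedbackStable {m : ℕ} (G : Matrix (Fin m) (Fin m) rhInfty)
    {γ : OnePoint ℝ → ℝ} {h : rhInfty} (hh : ∀ ω ∈ frequencies, ‖evalFreq ω h‖ ≤ |γ ω|)
    {w : Fin m → rhInfty} (hw : ∀ ω, ∑ i, ‖evalFreq ω (w i)‖ ^ 2 = 1) (ω₀ : OnePoint ℝ)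
    (hG : evalFreq ω₀ h • (G.map (evalFreq ω₀) *ᵥ fun i => evalFreq ω₀ (w i)) =
      -star fun i => evalFreq ω₀ (w i)) :
    ∃ H ∈ symmBall m γ, ¬ FeedbackStable (G.map Subtype.val) H := by
  set M : Matrix (Fin m) (Fin m) rhInfty := h • vecMulVec w w with hM
  have hmap (ω : OnePoint ℝ) : M.map (evalFreq ω) =
      evalFreq ω h • vecMulVec (fun i => evalFreq ω (w i)) fun i => evalFreq ω (w i) := by
    ext i j
    simp [hM, vecMulVec_apply]
  refine ⟨M.map Subtype.val, ⟨⟨isRHInfty_map _, fun ω hω => ?_⟩, ?_⟩, ?_⟩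
  · rw [freqResponse_map, maxSingularValue_eq_norm, hmap]
    exact (norm_smul_vecMulVec_le _ (hw ω)).trans (hh ω hω)
  · ext i j
    simp [hM, vecMulVec_apply, mul_comm]
  · rw [feedbackStable_iff]
    set v : Fin m → ℂ := fun i => evalFreq ω₀ (w i) with hv
    have hdot : v ⬝ᵥ star v = 1 := by
      have := hw ω₀
      simp only [dotProduct, Pi.star_apply, Complex.star_def, Complex.mul_conj']
      exact_mod_cast this
    -- Since `vᵀ v̄ = 1`, `H` sends `v̄` to `h v`, which `G` returns to `-v̄`.
    refine not_isUnit_one_add_mul ω₀ (v := star v) ?_ ?_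
    · intro h0
      simp [h0] at hdot
    · rw [hmap, smul_mulVec, vecMulVec_mulVec, hdot, mulVec_smul, MulOpposite.op_one, one_smul]
      exact hG

theorem exists_destabilizing_interior {m : ℕ} (hm : 0 < m) {G : Matrix (Fin m) (Fin m) rhInfty}
    (hGsymm : Gᵀ = G) {γ : OnePoint ℝ → ℝ} {e : rhInfty}
    (he : ∀ ω ∈ frequencies, ‖evalFreq ω e‖ ≤ |γ ω|) {x : ℝ} (hx : 0 < x)
    (hgain : 1 ≤ maxSingularValue (G.map (evalFreq (x : OnePoint ℝ))) *
      ‖evalFreq (x : OnePoint ℝ) e‖) :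
    ∃ H ∈ symmBall m γ, ¬ FeedbackStable (G.map Subtype.val) H := by
  set φ := evalFreq (x : OnePoint ℝ) with hφ
  have hAsymm : (G.map φ)ᵀ = G.map φ := by rw [← transpose_map, hGsymm]
  obtain ⟨v, hv, hAv⟩ := exists_takagi hm hAsymm
  set σ := maxSingularValue (G.map φ) with hσ
  set g := ‖φ e‖ with hg
  have hσg : σ * g ≠ 0 := by linarith
  have hσ0 : (σ : ℂ) ≠ 0 := by exact_mod_cast left_ne_zero_of_mul hσg
  have hg0 : (g : ℂ) ≠ 0 := by exact_mod_cast right_ne_zero_of_mul hσg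
  -- The phase of `-e` is moved into `w = z̄ v`; a square root is taken because `w` enters `w wᵀ`
  -- twice.
  obtain ⟨z, hz⟩ := IsAlgClosed.exists_pow_nat_eq (-(φ e / g)) (n := 2) two_pos
  have hz1 : ‖z‖ = 1 := by
    have h := congrArg norm hz
    rw [norm_pow, norm_neg, norm_div, Complex.norm_real, hg, norm_norm,
      div_self (right_ne_zero_of_mul hσg)] at h
    exact (pow_eq_one_iff_of_nonneg (norm_nonneg z) two_ne_zero).1 h
  have hzz : z * conj z = 1 := by
    rw [Complex.mul_conj', hz1]
    simp
  choose w hw hw' using fun i => exists_constant_gain_interpolant hx (conj z * v i)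
  have hwv : (fun i => φ (w i)) = conj z • v := funext hw
  -- Scaling by `(σ * g)⁻¹ ≤ 1` stays in the ball and makes the loop gain at `x` exactly one.
  refine exists_mem_symmBall_not_feedbackStable G (h := rhConst (σ * g)⁻¹ * e) (w := w)
    (fun ω hω => ?_) (fun ω => ?_) x ?_
  · rw [map_mul, evalFreq_rhConst, norm_mul, Complex.norm_real, Real.norm_eq_abs]
    refine (mul_le_of_le_one_left (norm_nonneg _) ?_).trans (he ω hω)
    rw [abs_inv, abs_of_pos (by linarith)]
    exact inv_le_one_of_one_le₀ hgain
  · simpa [hw', hz1] using hv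
  · rw [← hφ, hwv, mulVec_smul, hAv, map_mul, evalFreq_rhConst, star_smul, smul_smul, smul_smul,
      ← neg_smul]
    congr 1
    have he' : φ e = -(z ^ 2 * g) := by
      rw [hz]
      field_simp
    rw [he', Complex.star_def, Complex.conj_conj]
    push_cast
    field_simp
    linear_combination (-z) * hzz

theorem exists_destabilizing_of_real {m : ℕ} (hm : 0 < m) {G : Matrix (Fin m) (Fin m) rhInfty}
    (hGsymm : Gᵀ = G) {γ : OnePoint ℝ → ℝ} {e : rhInfty}
    (he : ∀ ω ∈ frequencies, ‖evalFreq ω e‖ ≤ |γ ω|) {ω₀ : OnePoint ℝ}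
    (hω₀ : ∀ r, conj (evalFreq ω₀ r) = evalFreq ω₀ r)
    (hgain : 1 ≤ maxSingularValue (G.map (evalFreq ω₀)) * ‖evalFreq ω₀ e‖) :
    ∃ H ∈ symmBall m γ, ¬ FeedbackStable (G.map Subtype.val) H := by
  set φ := evalFreq ω₀ with hφ
  have hAsymm : (G.map φ)ᵀ = G.map φ := by rw [← transpose_map, hGsymm]
  have hAreal : (G.map φ)ᴴ = G.map φ := by
    nth_rewrite 2 [← hAsymm]
    ext i j
    exact hω₀ _
  obtain ⟨v, hvr, hv, ε, hε, hAv⟩ := exists_real_eigenvector hm hAsymm hAreal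
  set σ := maxSingularValue (G.map φ) with hσ
  have heR : ((φ e).re : ℂ) = φ e := Complex.conj_eq_iff_re.1 (hω₀ e)
  set g := (φ e).re with hg
  have hnorm : ‖φ e‖ = |g| := by rw [← heR, Complex.norm_real, Real.norm_eq_abs]
  rw [hnorm] at hgain
  have hσg : σ * |g| ≠ 0 := by linarith
  have hσ0 : (σ : ℂ) ≠ 0 := by exact_mod_cast left_ne_zero_of_mul hσg
  have hg0 : (g : ℂ) ≠ 0 := by exact_mod_cast abs_ne_zero.1 (right_ne_zero_of_mul hσg)
  have hvR (i : Fin m) : ((v i).re : ℂ) = v i := Complex.conj_eq_iff_re.1 (congrFun hvr i)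
  -- The sign `-ε` turns the loop eigenvalue into `-1`; as `v` is real, constants serve for `w`.
  refine exists_mem_symmBall_not_feedbackStable G (h := rhConst (-ε * (σ * g)⁻¹) * e)
    (w := fun i => rhConst (v i).re) (fun ω hω => ?_) (fun ω => ?_) ω₀ ?_
  · rw [map_mul, evalFreq_rhConst, norm_mul, Complex.norm_real, Real.norm_eq_abs]
    refine (mul_le_of_le_one_left (norm_nonneg _) ?_).trans (he ω hω)
    rw [abs_mul, abs_neg, hε, one_mul, abs_inv, abs_mul, abs_of_nonneg (maxSingularValue_nonneg _)]
    exact inv_le_one_of_one_le₀ hgain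
  · simpa [evalFreq_rhConst, hvR] using hv
  · have hεsq : (ε : ℂ) ^ 2 = 1 := by
      rw [← Complex.ofReal_pow, ← sq_abs, hε]
      simp
    simp only [map_mul, evalFreq_rhConst, hvR]
    rw [hvr, ← hφ, hAv, ← heR, smul_smul, ← neg_one_smul ℂ v]
    congr 1
    push_cast
    field_simp
    linear_combination -hεsq

theorem conj_evalFreq_zero (r : rhInfty) :
    conj (evalFreq ((0 : ℝ) : OnePoint ℝ) r) = evalFreq ((0 : ℝ) : OnePoint ℝ) r := by
  rw [← evalFreq_neg, neg_zero]

theorem conj_evalFreq_infty (r : rhInfty) :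
    conj (evalFreq OnePoint.infty r) = evalFreq OnePoint.infty r :=
  Complex.conj_ofReal _

theorem exists_touching_gain {γ : OnePoint ℝ → ℝ} (hγ : IsRegularBound γ) {ω₀ : OnePoint ℝ}
    (hω₀ : ω₀ ∈ frequencies) (h0 : γ ω₀ ≠ 0) :
    ∃ e : rhInfty, ‖evalFreq ω₀ e‖ = |γ ω₀| ∧ ∀ ω ∈ frequencies, ‖evalFreq ω e‖ ≤ |γ ω| := by
  obtain ⟨Q, hQ, hQΓ⟩ := hγ.isRegularOnIcc.exists_polynomial_touching (freqCoord_mem_Icc ω₀)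
    (by simpa [freqOfCoord_freqCoord hω₀] using h0)
  obtain ⟨e, he⟩ := exists_norm_evalFreq_eq_abs_eval Q
  refine ⟨e, ?_, fun ω hω => ?_⟩
  · rw [he, hQ, freqOfCoord_freqCoord hω₀, abs_abs]
  · have := hQΓ _ (freqCoord_mem_Icc ω)
    rwa [freqOfCoord_freqCoord hω, ← he] at this

theorem ne_zero_and_one_le_mul_of_not_lt_inv {a b : ℝ}
    (h : ¬ ENNReal.ofReal a < (ENNReal.ofReal |b|)⁻¹) : b ≠ 0 ∧ 1 ≤ a * |b| := by
  have hb : b ≠ 0 := by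
    rintro rfl
    simp at h
  have hb' := abs_pos.2 hb
  rw [← ENNReal.ofReal_inv_of_pos hb', ENNReal.ofReal_lt_ofReal_iff (inv_pos.2 hb'), not_lt] at h
  exact ⟨hb, by rwa [← inv_le_iff_one_le_mul₀ hb']⟩

theorem smallGainCondition_of_feedbackStable {m : ℕ} {G : Matrix (Fin m) (Fin m) (RatFunc ℝ)}
    (hG : IsRHInfty G) (hGsymm : G.transpose = G) {γ : OnePoint ℝ → ℝ} (hγ : IsRegularBound γ)
    (h : ∀ H ∈ symmBall m γ, FeedbackStable G H) : SmallGainCondition G γ := by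
  obtain ⟨G, rfl⟩ := hG.exists_lift
  have hGsymm' : Gᵀ = G := Matrix.map_injective Subtype.val_injective hGsymm
  intro ω hω
  by_contra hlt
  obtain ⟨h0, hgain⟩ := ne_zero_and_one_le_mul_of_not_lt_inv hlt
  obtain ⟨e, he0, he⟩ := exists_touching_gain hγ hω h0
  rw [freqResponse_map, ← he0] at hgain
  have hm : 0 < m := by
    rcases m.eq_zero_or_pos with rfl | hm
    · rw [maxSingularValue, LinearMap.singularValues_of_finrank_le _ (by simp), zero_mul] at hgain
      norm_num at hgain
    · exact hm
  obtain ⟨H, hH, hns⟩ : ∃ H ∈ symmBall m γ, ¬ FeedbackStable (G.map Subtype.val) H := by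
    rcases hω with rfl | ⟨x, hx, rfl⟩
    · exact exists_destabilizing_of_real hm hGsymm' he conj_evalFreq_infty hgain
    · rcases (Set.mem_Ici.1 hx).eq_or_lt with rfl | hx
      · exact exists_destabilizing_of_real hm hGsymm' he conj_evalFreq_zero hgain
      · exact exists_destabilizing_interior hm hGsymm' he hx hgain
  exact hns (h H hH)

end SmallGain
end

theorem mainTheorem4 (m : ℕ) (G : Matrix (Fin m) (Fin m) (RatFunc ℝ))
    (hG : SmallGain.IsRHInfty G) (hGsymm : G.transpose = G) (γ : OnePoint ℝ → ℝ) :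
    (SmallGain.SmallGainCondition G γ →
      ∀ H ∈ SmallGain.symmBall m γ, SmallGain.FeedbackStable G H) ∧
    (SmallGain.IsRegularBound γ →
      ((∀ H ∈ SmallGain.symmBall m γ, SmallGain.FeedbackStable G H) ↔
        SmallGain.SmallGainCondition G γ)) :=
  ⟨fun h _ hH => SmallGain.feedbackStable_of_smallGainCondition hG hGsymm h hH, fun hγ =>
    ⟨SmallGain.smallGainCondition_of_feedbackStable hG hGsymm hγ, fun h _ hH =>
      SmallGain.feedbackStable_of_smallGainCondition hG hGsymm h hH⟩⟩
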